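/- **Setting.** Let $A$ be a pro-$C^*$-algebra, i.e. a complete Hausdorff topological $*$-algebra over $\mathbb{C}$ whose topology is given by an upward directed family $\{p_\lambda\}_{\lambda\in\Lambda}$ of $C^*$-seminorms, and put $A_\lambda=A/\ker p_\lambda$ with the norm induced by $p_\lambda$ and $\pi^A_\lambda:A\to A_\lambda$ the quotient map. A (right) Hilbert $A$-module is a right $A$-module and complex vector space $X$ with an $A$-valued inner product $\langle\cdot,\cdot\rangle_A$, $\mathbb{C}$- and $A$-linear in the second variable, with $\langle x,y\rangle_A^*=\langle y,x\rangle_A$, $\langle x,x\rangle_A\ge 0$, and $\langle x,x\rangle_A=0$ iff $x=0$, that is complete for the seminorms $p_\lambda^A(x)=p_\lambda(\langle x,x\rangle_A)^{1/2}$. A left Hilbert $A$-module is defined in the same way, with a left action and an inner product ${}_A\langle\cdot,\cdot\rangle$ that is linear in the first variable, and with the seminorms ${}^Ap_\lambda(x)=p_\lambda({}_A\langle x,x\rangle)^{1/2}$. A Hilbert $A$-$A$ pro-$C^*$-bimodule is a space $X$ that is both a left and a right Hilbert $A$-module such that ${}_A\langle x,y\rangle z=x\langle y,z\rangle_A$,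 $p^A_\lambda(ax)\le p_\lambda(a)\,p^A_\lambda(x)$ and ${}^Ap_\lambda(xa)\le p_\lambda(a)\,{}^Ap_\lambda(x)$ for all $x,y,z\in X$, $a\in A$, $\lambda\in\Lambda$. For a Hilbert $A$-module $X$, let $L_A(X)$ be the $*$-algebra of adjointable module morphisms $X\to X$, with the topology given by the seminorms $p_{\lambda,L_A(X)}(T)=\sup\{p_\lambda^A(Tx):p_\lambda^A(x)\le 1\}$, and let $K_A(X)$ be the closure in $L_A(X)$ of the linear span of the operators $\theta_{y,x}(z)=y\langle x,z\rangle_A$. Let $X_\lambda=X/\ker p_\lambda^A$, a Hilbert $A_\lambda$-module, and let $\pi_\lambda^{L_A(X)}:L_A(X)\to L_{A_\lambda}(X_\lambda)$ be the canonical map. A pro-$C^*$-correspondence is a triple $(X,A,\varphi_X)$ of a pro-$C^*$-algebra $A$, a Hilbert $A$-module $X$ and a continuous $*$-morphism $\varphi_X:A\to L_A(X)$. For it put $$J_X^\lambda=\{a\in A:\ \pi_\lambda^{L_A(X)}(\varphi_X(a))\in K_{A_\lambda}(X_\lambda)\ \text{ and }\ \pi_\lambda^A(ab)=0\ \text{ for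 all } b\in\ker(\pi_\lambda^{L_A(X)}\circ\varphi_X)\},\qquad \mathcal{J}_X=\bigcap_{\lambda\in\Lambda}J_X^\lambda .$$ **Proposition.** Let $(X,A,\varphi_X)$ be a pro-$C^*$-correspondence. Then the following assertions are equivalent: 1. $X$ has the structure of a Hilbert $A$-$A$ pro-$C^*$-bimodule that is compatible with the correspondence; that is, there is a Hilbert $A$-$A$ pro-$C^*$-bimodule on $X$ whose right Hilbert $A$-module is the given one and whose left action is $ax=\varphi_X(a)(x)$, $a\in A$, $x\in X$. 2. $\varphi_X|_{\mathcal{J}_X}$ is a pro-$C^*$-isomorphism (a $*$-isomorphism that is a homeomorphism) of $\mathcal{J}_X$ onto $K_A(X)$, and $p_{\lambda,L_A(X)}(\varphi_X(a))=p_\lambda(a)$ for all $a\in\mathcal{J}_X$ and $\lambda\in\Lambda$. -/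

import Mathlib

universe u u' v w
open Topology Filter
open scoped ENNReal

noncomputable section

namespace ProCStar

/-! ### Auxiliary facts on C*-algebras -/

/-- The completion of a normed unital star algebra with the C*-identity is a C*-algebra. -/
theorem exists_cstarAlgebra_completion {R : Type u} [NormedRing R] [StarRing R] [CStarRing R]
    [NormedAlgebra ℂ R] [StarModule ℂ R] :
    ∃ (D : Type u) (_ : CStarAlgebra D) (f : R →⋆ₙₐ[ℂ] D), ∀ a, ‖f a‖ = ‖a‖ := by
  let D := UniformSpace.Completion R
  have hu : UniformContinuous (star : R → R) := (starNormedAddGroupHom (E := R)).uniformContinuous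
  let st : D → D := UniformSpace.Completion.map star
  have hc : Continuous st := UniformSpace.Completion.continuous_map
  have hst : ∀ a : R, st (a : D) = ((star a : R) : D) := UniformSpace.Completion.map_coe hu
  let _ : StarRing D :=
    { star := st
      star_involutive := fun x => by
        refine UniformSpace.Completion.induction_on x (isClosed_eq (hc.comp hc) continuous_id) ?_
        intro a
        rw [hst, hst, star_star]
      star_mul := fun x y => by
        refine UniformSpace.Completion.induction_on₂ x y
          (isClosed_eq (hc.comp continuous_mul)
            ((hc.comp continuous_snd).mul (hc.comp continuous_fst))) ?_
        intro a b
        change st ((a : D) * b) = st b * st a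
        rw [← UniformSpace.Completion.coe_mul, hst, hst, hst, star_mul,
          UniformSpace.Completion.coe_mul]
      star_add := fun x y => by
        refine UniformSpace.Completion.induction_on₂ x y
          (isClosed_eq (hc.comp continuous_add)
            ((hc.comp continuous_fst).add (hc.comp continuous_snd))) ?_
        intro a b
        change st ((a : D) + b) = st a + st b
        rw [← UniformSpace.Completion.coe_add, hst, hst, hst, star_add,
          UniformSpace.Completion.coe_add] }
  let _ : NormedAlgebra ℂ D :=
    { (inferInstance : Algebra ℂ D) with
      norm_smul_le := fun c x => norm_smul_le c x }
  let _ : CStarAlgebra D :=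
    { (inferInstance : NormedRing D), (inferInstance : StarRing D),
      (inferInstance : NormedAlgebra ℂ D) with
      complete := CompleteSpace.complete
      norm_mul_self_le := fun x => by
        refine UniformSpace.Completion.induction_on x
          (isClosed_le (by fun_prop) ((hc.mul continuous_id).norm)) ?_
        intro a
        change _ ≤ ‖st a * a‖
        rw [hst, ← UniformSpace.Completion.coe_mul, UniformSpace.Completion.norm_coe,
          UniformSpace.Completion.norm_coe]
        exact (CStarRing.norm_star_mul_self).ge
      star_smul := fun c x => by
        refine UniformSpace.Completion.induction_on x
          (isClosed_eq (hc.comp (continuous_const_smul c)) ((continuous_const_smul (star c)).comp hc)) ?_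
        intro a
        change st (c • (a : D)) = star c • st a
        rw [← UniformSpace.Completion.coe_smul, hst, hst, star_smul,
          UniformSpace.Completion.coe_smul] }
  refine ⟨D, inferInstance, 
    { toFun := fun a => (a : D)
      map_smul' := fun c a => UniformSpace.Completion.coe_smul c a
      map_zero' := UniformSpace.Completion.coe_zero
      map_add' := fun a b => UniformSpace.Completion.coe_add a b
      map_mul' := fun a b => UniformSpace.Completion.coe_mul a b
      map_star' := fun a => (hst a).symm }, fun a => UniformSpace.Completion.norm_coe a⟩

theorem norm_sq_le_of_quadratic_nonneg {D : Type*} [CStarAlgebra D] (a b c : D)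
    (h : ∀ s : ℝ, ∃ w : D, c - (2 * s) • (star b * b) + s ^ 2 • (star b * a * b) = star w * w)
    (ha : ∃ u, a = star u * u) : ‖b‖ ^ 2 ≤ ‖a‖ * ‖c‖ := by
  let _ : PartialOrder D := CStarAlgebra.spectralOrder D
  have _ : StarOrderedRing D := CStarAlgebra.spectralOrderedRing D
  have ha0 : 0 ≤ a := by obtain ⟨u, rfl⟩ := ha; exact star_mul_self_nonneg u
  have h1 : star b * a * b ≤ ‖a‖ • (star b * b) := 
    CStarAlgebra.star_left_conjugate_le_norm_smul
  have key : ∀ s : ℝ, (2 * s - s ^ 2 * ‖a‖) • (star b * b) ≤ c := by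
    intro s
    obtain ⟨w, hw⟩ := h s
    have h2 : 0 ≤ c - (2 * s) • (star b * b) + s ^ 2 • (star b * a * b) := by
      rw [hw]; exact star_mul_self_nonneg w
    have h3 : s ^ 2 • (star b * a * b) ≤ s ^ 2 • (‖a‖ • (star b * b)) := by gcongr
    rw [sub_smul, mul_smul (s ^ 2)]
    rw [← sub_nonneg]
    calc 0 ≤ _ := h2
      _ ≤ c - (2 * s) • (star b * b) + s ^ 2 • (‖a‖ • (star b * b)) := by gcongr
      _ = _ := by abel
  have key2 : ∀ s : ℝ, 0 ≤ 2 * s - s ^ 2 * ‖a‖ → (2 * s - s ^ 2 * ‖a‖) * ‖b‖ ^ 2 ≤ ‖c‖ := by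
    intro s hs
    have h4 := CStarAlgebra.norm_le_norm_of_nonneg_of_le
      (smul_nonneg hs (star_mul_self_nonneg b)) (key s)
    rwa [norm_smul, Real.norm_of_nonneg hs, CStarRing.norm_star_mul_self, ← sq] at h4
  rcases (norm_nonneg a).eq_or_lt with h0 | h0
  · rw [← h0] at key2 ⊢
    by_contra hb
    rw [zero_mul, not_le] at hb
    have := key2 ((‖c‖ + 1) / ‖b‖ ^ 2) (by simp; positivity)
    have hb' : ‖b‖ ^ 2 ≠ 0 := hb.ne'
    have h5 : (2 * ((‖c‖ + 1) / ‖b‖ ^ 2) - ((‖c‖ + 1) / ‖b‖ ^ 2) ^ 2 * 0) * ‖b‖ ^ 2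
        = 2 * (‖c‖ + 1) := by
      rw [mul_zero, sub_zero, mul_assoc, div_mul_cancel₀ _ hb']
    rw [h5] at this
    linarith [norm_nonneg c]
  · have := key2 (1 / ‖a‖) (by field_simp; norm_num)
    field_simp at this
    nlinarith


/-! ### C*-seminorms and the C*-algebras `A / ker p` -/

section CStarSeminorm

/-- A C*-seminorm on a complex star algebra: a submultiplicative seminorm with
`p (a* a) = p a ^ 2`. -/
structure CStarSeminorm (A : Type u) [NonUnitalRing A] [StarRing A] [Module ℂ A]
    extends Seminorm ℂ A where
  mul_le' : ∀ a b : A, toFun (a * b) ≤ toFun a * toFun b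
  star_mul_self' : ∀ a : A, toFun (star a * a) = toFun a ^ 2

variable {A : Type u} [NonUnitalRing A] [StarRing A] [Module ℂ A]

namespace CStarSeminorm

instance : CoeFun (CStarSeminorm A) (fun _ => A → ℝ) := ⟨fun p => p.toSeminorm⟩

theorem mul_le (p : CStarSeminorm A) (a b : A) : p (a * b) ≤ p a * p b := p.mul_le' a b

theorem star_mul_self (p : CStarSeminorm A) (a : A) : p (star a * a) = p a ^ 2 :=
  p.star_mul_self' a

theorem star_eq (p : CStarSeminorm A) (a : A) : p (star a) = p a := by
  have key : ∀ a : A, p a ≤ p (star a) := by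
    intro a
    have h1 := p.mul_le (star a) a
    rw [p.star_mul_self] at h1
    rcases (apply_nonneg p.toSeminorm a).eq_or_lt with h0 | h0
    · rw [← h0]; exact apply_nonneg _ _
    · nlinarith
  refine le_antisymm ?_ (key a)
  simpa using key (star a)

/-- `N_p = {a | p a = 0}`. -/
def ker (p : CStarSeminorm A) : Submodule ℂ A where
  carrier := {a | p a = 0}
  zero_mem' := map_zero p.toSeminorm
  add_mem' {a b} ha hb := le_antisymm
    ((map_add_le_add p.toSeminorm a b).trans (by rw [ha, hb, add_zero])) (apply_nonneg _ _)
  smul_mem' c a ha := by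
    change p.toSeminorm (c • a) = 0
    rw [map_smul_eq_mul, show p.toSeminorm a = 0 from ha, mul_zero]

theorem mem_ker {p : CStarSeminorm A} {a : A} : a ∈ p.ker ↔ p a = 0 := Iff.rfl

theorem mul_mem_ker_left (p : CStarSeminorm A) {a : A} (ha : a ∈ p.ker) (b : A) :
    a * b ∈ p.ker :=
  le_antisymm ((p.mul_le a b).trans (by rw [mem_ker.1 ha, zero_mul])) (apply_nonneg _ _)

theorem mul_mem_ker_right (p : CStarSeminorm A) (a : A) {b : A} (hb : b ∈ p.ker) :
    a * b ∈ p.ker :=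
  le_antisymm ((p.mul_le a b).trans (by rw [mem_ker.1 hb, mul_zero])) (apply_nonneg _ _)

theorem star_mem_ker (p : CStarSeminorm A) {a : A} (ha : a ∈ p.ker) : star a ∈ p.ker := by
  rw [mem_ker, p.star_eq]; exact ha

/-- The quotient normed star algebra `A_p = A / N_p`. -/
def Quot (p : CStarSeminorm A) : Type u := A ⧸ p.ker

variable (p : CStarSeminorm A)

instance : AddCommGroup p.Quot := inferInstanceAs (AddCommGroup (A ⧸ p.ker))

instance : Module ℂ p.Quot := inferInstanceAs (Module ℂ (A ⧸ p.ker))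

/-- The canonical map `A → A_p`. -/
def proj : A →ₗ[ℂ] p.Quot := p.ker.mkQ

theorem proj_surjective : Function.Surjective p.proj := p.ker.mkQ_surjective

theorem proj_eq_iff {a b : A} : p.proj a = p.proj b ↔ p (a - b) = 0 :=
  Submodule.Quotient.eq p.ker

theorem proj_eq_zero {a : A} : p.proj a = 0 ↔ p a = 0 :=
  Submodule.Quotient.mk_eq_zero p.ker

instance : Mul p.Quot :=
  ⟨Quotient.map₂ (· * ·) (by
    intro a a' ha b b' hb
    replace ha := (Submodule.quotientRel_def p.ker).1 ha
    replace hb := (Submodule.quotientRel_def p.ker).1 hb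
    refine (Submodule.quotientRel_def p.ker).2 ?_
    have : a * b - a' * b' = (a - a') * b + a' * (b - b') := by noncomm_ring
    rw [this]
    exact add_mem (p.mul_mem_ker_left ha b) (p.mul_mem_ker_right a' hb))⟩

instance : Star p.Quot :=
  ⟨Quotient.map star (by
    intro a a' ha
    replace ha := (Submodule.quotientRel_def p.ker).1 ha
    refine (Submodule.quotientRel_def p.ker).2 ?_
    rw [← star_sub]
    exact p.star_mem_ker ha)⟩

instance : Norm p.Quot :=
  ⟨Quotient.lift p (by
    intro a a' ha
    have ha' : p (a - a') = 0 := (Submodule.quotientRel_def p.ker).1 ha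
    have h1 := map_add_le_add p.toSeminorm (a - a') a'
    have h2 := map_sub_rev p.toSeminorm a a'
    have h3 := map_add_le_add p.toSeminorm (a' - a) a
    rw [sub_add_cancel] at h1 h3
    change p a = p a'
    linarith)⟩

theorem proj_mul (a b : A) : p.proj (a * b) = p.proj a * p.proj b := rfl

theorem proj_star (a : A) : p.proj (star a) = star (p.proj a) := rfl

theorem norm_proj (a : A) : ‖p.proj a‖ = p a := rfl

instance : NonUnitalRing p.Quot :=
  { (inferInstance : AddCommGroup p.Quot), (inferInstance : Mul p.Quot) with
    left_distrib := by
      intro x y z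
      obtain ⟨a, rfl⟩ := p.proj_surjective x
      obtain ⟨b, rfl⟩ := p.proj_surjective y
      obtain ⟨c, rfl⟩ := p.proj_surjective z
      simp only [← map_add, ← proj_mul, mul_add]
    right_distrib := by
      intro x y z
      obtain ⟨a, rfl⟩ := p.proj_surjective x
      obtain ⟨b, rfl⟩ := p.proj_surjective y
      obtain ⟨c, rfl⟩ := p.proj_surjective z
      simp only [← map_add, ← proj_mul, add_mul]
    zero_mul := by
      intro x
      obtain ⟨a, rfl⟩ := p.proj_surjective x
      rw [← map_zero p.proj, ← proj_mul, zero_mul]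
    mul_zero := by
      intro x
      obtain ⟨a, rfl⟩ := p.proj_surjective x
      rw [← map_zero p.proj, ← proj_mul, mul_zero]
    mul_assoc := by
      intro x y z
      obtain ⟨a, rfl⟩ := p.proj_surjective x
      obtain ⟨b, rfl⟩ := p.proj_surjective y
      obtain ⟨c, rfl⟩ := p.proj_surjective z
      simp only [← proj_mul, mul_assoc] }

instance : StarRing p.Quot where
  star_involutive := by
    intro x
    obtain ⟨a, rfl⟩ := p.proj_surjective x
    rw [← proj_star, ← proj_star, star_star]
  star_mul := by
    intro x y
    obtain ⟨a, rfl⟩ := p.proj_surjective x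
    obtain ⟨b, rfl⟩ := p.proj_surjective y
    rw [← proj_mul, ← proj_star, star_mul, proj_mul, proj_star, proj_star]
  star_add := by
    intro x y
    obtain ⟨a, rfl⟩ := p.proj_surjective x
    obtain ⟨b, rfl⟩ := p.proj_surjective y
    rw [← map_add, ← proj_star, star_add, map_add, proj_star, proj_star]

instance [StarModule ℂ A] : StarModule ℂ p.Quot where
  star_smul := by
    intro c x
    obtain ⟨a, rfl⟩ := p.proj_surjective x
    rw [← map_smul, ← proj_star, star_smul, map_smul, proj_star]

instance [IsScalarTower ℂ A A] : IsScalarTower ℂ p.Quot p.Quot where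
  smul_assoc := by
    intro c x y
    obtain ⟨a, rfl⟩ := p.proj_surjective x
    obtain ⟨b, rfl⟩ := p.proj_surjective y
    change (c • p.proj a) * p.proj b = c • (p.proj a * p.proj b)
    rw [← map_smul, ← proj_mul, ← proj_mul, smul_mul_assoc, map_smul]

instance [SMulCommClass ℂ A A] : SMulCommClass ℂ p.Quot p.Quot where
  smul_comm := by
    intro c x y
    obtain ⟨a, rfl⟩ := p.proj_surjective x
    obtain ⟨b, rfl⟩ := p.proj_surjective y
    change c • (p.proj a * p.proj b) = p.proj a * (c • p.proj b)
    rw [← map_smul, ← proj_mul, ← proj_mul, mul_smul_comm, map_smul]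

/-- The C*-norm `‖a + N_p‖ = p a` of `A_p`, as a C*-seminorm. -/
def quotNorm : CStarSeminorm p.Quot where
  toFun x := ‖x‖
  map_zero' := map_zero p.toSeminorm
  add_le' := by
    intro x y
    obtain ⟨a, rfl⟩ := p.proj_surjective x
    obtain ⟨b, rfl⟩ := p.proj_surjective y
    exact map_add_le_add p.toSeminorm a b
  neg' := by
    intro x
    obtain ⟨a, rfl⟩ := p.proj_surjective x
    exact map_neg_eq_map p.toSeminorm a
  smul' := by
    intro c x
    obtain ⟨a, rfl⟩ := p.proj_surjective x
    exact map_smul_eq_mul p.toSeminorm c a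
  mul_le' := by
    intro x y
    obtain ⟨a, rfl⟩ := p.proj_surjective x
    obtain ⟨b, rfl⟩ := p.proj_surjective y
    exact p.mul_le a b
  star_mul_self' := by
    intro x
    obtain ⟨a, rfl⟩ := p.proj_surjective x
    exact p.star_mul_self a

theorem quotNorm_proj (a : A) : p.quotNorm (p.proj a) = p a := rfl

/-- A C*-seminorm is the pull-back of the norm of a C*-algebra. -/
theorem exists_cstarAlgebra [IsScalarTower ℂ A A] [SMulCommClass ℂ A A] [StarModule ℂ A] :
    ∃ (D : Type u) (_ : CStarAlgebra D) (f : A →⋆ₙₐ[ℂ] D), ∀ a, ‖f a‖ = p a := by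
  let _ : NormedAddCommGroup p.Quot := AddGroupNorm.toNormedAddCommGroup
    { toFun := fun x => ‖x‖
      map_zero' := map_zero p.quotNorm.toSeminorm
      add_le' := map_add_le_add p.quotNorm.toSeminorm
      neg' := map_neg_eq_map p.quotNorm.toSeminorm
      eq_zero_of_map_eq_zero' := by
        intro x hx
        obtain ⟨a, rfl⟩ := p.proj_surjective x
        exact p.proj_eq_zero.2 hx }
  let _ : NonUnitalNormedRing p.Quot :=
    { (inferInstance : NormedAddCommGroup p.Quot), (inferInstance : NonUnitalRing p.Quot) with
      norm_mul_le := p.quotNorm.mul_le }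
  let _ : NormedSpace ℂ p.Quot :=
    { norm_smul_le := fun c x => (map_smul_eq_mul p.quotNorm.toSeminorm c x).le }
  have _ : CStarRing p.Quot :=
    ⟨fun x => by
      have := p.quotNorm.star_mul_self x
      rw [← sq]; exact this.ge⟩
  obtain ⟨D, hD, f, hf⟩ := exists_cstarAlgebra_completion (R := Unitization ℂ p.Quot)
  refine ⟨D, hD, f.comp ((Unitization.inrNonUnitalStarAlgHom ℂ p.Quot).comp
    { toFun := p.proj
      map_smul' := map_smul p.proj
      map_zero' := map_zero p.proj
      map_add' := map_add p.proj
      map_mul' := p.proj_mul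
      map_star' := p.proj_star }), fun a => ?_⟩
  exact (hf _).trans (Unitization.norm_inr (𝕜 := ℂ) (p.proj a))

end CStarSeminorm

end CStarSeminorm


/-! ### Topologies and completeness given by families of seminorms -/

/-- The topology on `V` defined by a family `q` of (extended real valued) seminorms: the finite intersections of the
balls `{y | q i (y - x) < ε}` form a neighbourhood base at `x`. -/
@[reducible] def seminormTopology {ι V : Type*} [AddCommGroup V] (q : ι → V → ℝ≥0∞) :
    TopologicalSpace V where
  IsOpen U := ∀ x ∈ U, ∃ s : Finset ι, ∃ ε : ℝ≥0∞, 0 < ε ∧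
    ∀ y, (∀ i ∈ s, q i (y - x) < ε) → y ∈ U
  isOpen_univ := fun _ _ => ⟨∅, 1, one_pos, fun _ _ => Set.mem_univ _⟩
  isOpen_inter := by
    classical
    intro U V hU hV x hx
    obtain ⟨s, ε, hε, h⟩ := hU x hx.1
    obtain ⟨t, δ, hδ, h'⟩ := hV x hx.2
    refine ⟨s ∪ t, min ε δ, lt_min hε hδ, fun y hy => ⟨h y fun i hi => ?_, h' y fun i hi => ?_⟩⟩
    · exact (hy i (Finset.mem_union_left _ hi)).trans_le (min_le_left _ _)
    · exact (hy i (Finset.mem_union_right _ hi)).trans_le (min_le_right _ _)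
  isOpen_sUnion := by
    intro S hS x hx
    obtain ⟨U, hU, hxU⟩ := hx
    obtain ⟨s, ε, hε, h⟩ := hS U hU x hxU
    exact ⟨s, ε, hε, fun y hy => ⟨U, hU, h y hy⟩⟩

/-- `V` is complete for the family `q` of seminorms: every filter that is Cauchy for each of the
seminorms `q i` has a limit for all of them. -/
def IsSeminormComplete {ι V : Type*} [AddCommGroup V] (q : ι → V → ℝ) : Prop :=
  ∀ F : Filter V, F.NeBot →
    (∀ i, ∀ ε : ℝ, 0 < ε → ∃ s ∈ F, ∀ x ∈ s, ∀ y ∈ s, q i (x - y) < ε) →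
    ∃ x, ∀ i, Tendsto (fun y => q i (y - x)) F (𝓝 0)

/-! ### Pro-C*-algebras -/

/-- The complex star algebra `A` is a pro-C*-algebra, with topology given by the directed family
`p` of C*-seminorms: it is Hausdorff and complete, and `p` defines its topology. -/
structure IsProCStarAlgebra {A : Type u} [NonUnitalRing A] [StarRing A] [Module ℂ A]
    [UniformSpace A] {Λ : Type*} (p : Λ → CStarSeminorm A) : Prop where
  isUniformAddGroup : IsUniformAddGroup A
  t2Space : T2Space A
  completeSpace : CompleteSpace A
  directed : Directed (· ≤ ·) (fun i => (p i).toSeminorm)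
  withSeminorms : WithSeminorms (𝕜 := ℂ) fun i => (p i).toSeminorm

/-! ### Inner product modules -/

/-- A right `A`-module `X` with an `A`-valued inner product, linear in the second variable
(no completeness is required). An element of `A` is positive if it is of the form `b* b`. -/
structure InnerModule (A : Type u) [NonUnitalRing A] [StarRing A] [Module ℂ A]
    (X : Type v) [AddCommGroup X] [Module ℂ X] where
  /-- the right action `x a` -/
  act : X → A → X
  add_act : ∀ x y a, act (x + y) a = act x a + act y a
  act_add : ∀ x a b, act x (a + b) = act x a + act x b
  act_mul : ∀ x a b, act x (a * b) = act (act x a) b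
  smul_act : ∀ (c : ℂ) x a, act (c • x) a = c • act x a
  act_smul : ∀ (c : ℂ) x a, act x (c • a) = c • act x a
  /-- the inner product `⟨x, y⟩` -/
  inner : X → X → A
  inner_add_right : ∀ x y z, inner x (y + z) = inner x y + inner x z
  inner_smul_right : ∀ (c : ℂ) x y, inner x (c • y) = c • inner x y
  inner_act_right : ∀ x y a, inner x (act y a) = inner x y * a
  star_inner : ∀ x y, star (inner x y) = inner y x
  inner_self_nonneg : ∀ x, ∃ b, inner x x = star b * b
  inner_self_eq_zero : ∀ x, inner x x = 0 ↔ x = 0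

section InnerModule

variable {A : Type u} [NonUnitalRing A] [StarRing A] [Module ℂ A]
  {X : Type v} [AddCommGroup X] [Module ℂ X]

namespace InnerModule

/-- The seminorm `p^A(x) = p(⟨x, x⟩)^(1/2)`. -/
def seminorm (E : InnerModule A X) (p : CStarSeminorm A) (x : X) : ℝ := √(p (E.inner x x))

variable (E : InnerModule A X)

theorem inner_add_left (x y z : X) : E.inner (x + y) z = E.inner x z + E.inner y z := by
  rw [← E.star_inner, E.inner_add_right, star_add, E.star_inner, E.star_inner]

theorem inner_act_left (x y : X) (a : A) : E.inner (E.act x a) y = star a * E.inner x y := by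
  rw [← E.star_inner, E.inner_act_right, star_mul, E.star_inner]

theorem inner_smul_left [StarModule ℂ A] (c : ℂ) (x y : X) :
    E.inner (c • x) y = star c • E.inner x y := by
  rw [← E.star_inner, E.inner_smul_right, star_smul, E.star_inner]

theorem inner_zero_right (x : X) : E.inner x 0 = 0 := by
  simpa using E.inner_smul_right 0 x 0

theorem inner_sub_right (x y z : X) : E.inner x (y - z) = E.inner x y - E.inner x z := by
  have := E.inner_add_right x (y - z) z
  rw [sub_add_cancel] at this
  rw [this, add_sub_cancel_right]

theorem inner_sub_left (x y z : X) : E.inner (x - y) z = E.inner x z - E.inner y z := by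
  have := E.inner_add_left (x - y) y z
  rw [sub_add_cancel] at this
  rw [this, add_sub_cancel_right]

theorem ext_inner {x y : X} (h : ∀ z, E.inner z x = E.inner z y) : x = y := by
  rw [← sub_eq_zero, ← E.inner_self_eq_zero, E.inner_sub_right, h, sub_self]

variable [IsScalarTower ℂ A A] [SMulCommClass ℂ A A] [StarModule ℂ A]

/-- The Cauchy–Schwarz inequality. -/
theorem cauchySchwarz (p : CStarSeminorm A) (x y : X) :
    p (E.inner x y) ^ 2 ≤ p (E.inner x x) * p (E.inner y y) := by
  obtain ⟨D, _, f, hf⟩ := p.exists_cstarAlgebra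
  rw [← hf, ← hf, ← hf]
  refine norm_sq_le_of_quadratic_nonneg _ _ _ ?_ ?_
  · intro s
    obtain ⟨w, hw⟩ :=
      E.inner_self_nonneg (y - ((s : ℝ) : ℂ) • E.act x (E.inner x y))
    refine ⟨f w, ?_⟩
    rw [show star (f w) * f w = f (star w * w) by rw [map_mul, map_star], ← hw]
    simp only [E.inner_sub_left, E.inner_sub_right, E.inner_smul_left, E.inner_smul_right,
      E.inner_act_left, E.inner_act_right, E.star_inner, map_sub, map_smul, map_mul]
    rw [← map_star, E.star_inner]
    simp only [RCLike.star_def, Complex.conj_ofReal, Complex.coe_smul, mul_assoc]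
    module
  · obtain ⟨u, hu⟩ := E.inner_self_nonneg x
    exact ⟨f u, by rw [hu, map_mul, map_star]⟩

theorem inner_eq_zero_left {p : CStarSeminorm A} {x : X} (hx : p (E.inner x x) = 0) (y : X) :
    p (E.inner x y) = 0 := by
  have := E.cauchySchwarz p x y
  rw [hx, zero_mul] at this
  exact pow_eq_zero_iff two_ne_zero |>.1 (le_antisymm this (sq_nonneg _))

theorem inner_eq_zero_right {p : CStarSeminorm A} {x : X} (hx : p (E.inner x x) = 0) (y : X) :
    p (E.inner y x) = 0 := by
  rw [← E.star_inner, p.star_eq]; exact E.inner_eq_zero_left hx y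

theorem seminorm_eq_zero {p : CStarSeminorm A} {x : X} :
    E.seminorm p x = 0 ↔ p (E.inner x x) = 0 :=
  Real.sqrt_eq_zero (apply_nonneg p.toSeminorm _)

/-- `N_p^A = {x | p^A(x) = 0}`. -/
def ker (p : CStarSeminorm A) : Submodule ℂ X where
  carrier := {x | E.seminorm p x = 0}
  zero_mem' := by
    change E.seminorm p 0 = 0
    rw [E.seminorm_eq_zero, E.inner_zero_right]
    exact map_zero p.toSeminorm
  add_mem' {x y} hx hy := by
    replace hx := E.seminorm_eq_zero.1 hx
    replace hy := E.seminorm_eq_zero.1 hy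
    refine E.seminorm_eq_zero.2 (CStarSeminorm.mem_ker.1 ?_)
    rw [E.inner_add_left]
    exact add_mem (E.inner_eq_zero_left hx _) (E.inner_eq_zero_left hy _)
  smul_mem' c x hx := by
    refine E.seminorm_eq_zero.2 (CStarSeminorm.mem_ker.1 ?_)
    rw [E.inner_smul_right]
    exact Submodule.smul_mem _ _ (E.inner_eq_zero_right (E.seminorm_eq_zero.1 hx) _)

theorem mem_ker {p : CStarSeminorm A} {x : X} : x ∈ E.ker p ↔ p (E.inner x x) = 0 :=
  E.seminorm_eq_zero

theorem act_mem_ker_left {p : CStarSeminorm A} {x : X} (hx : x ∈ E.ker p) (a : A) :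
    E.act x a ∈ E.ker p := by
  rw [E.mem_ker, E.inner_act_right, ← CStarSeminorm.mem_ker]
  exact p.mul_mem_ker_left (E.inner_eq_zero_right (E.mem_ker.1 hx) _) a

theorem act_mem_ker_right {p : CStarSeminorm A} (x : X) {a : A} (ha : a ∈ p.ker) :
    E.act x a ∈ E.ker p := by
  rw [E.mem_ker, E.inner_act_right, ← CStarSeminorm.mem_ker]
  exact p.mul_mem_ker_right _ ha

/-- The inner product `A_p`-module `X_p = X / N_p^A`, with
`(x + N_p^A)(a + N_p) = xa + N_p^A` and `⟨x + N_p^A, y + N_p^A⟩ = ⟨x, y⟩ + N_p`. -/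
def quot (p : CStarSeminorm A) : InnerModule p.Quot (X ⧸ E.ker p) where
  act := Quotient.map₂ E.act (by
    intro x x' hx a a' ha
    replace hx := (Submodule.quotientRel_def _).1 hx
    replace ha := (Submodule.quotientRel_def p.ker).1 ha
    refine (Submodule.quotientRel_def _).2 ?_
    have h1 : E.act x a - E.act x' a' = E.act (x - x') a + E.act x' (a - a') := by
      have h2 := E.add_act (x - x') x' a
      have h3 := E.act_add x' (a - a') a'
      rw [sub_add_cancel] at h2 h3
      rw [h2, h3]; abel
    rw [h1]
    exact add_mem (E.act_mem_ker_left hx a) (E.act_mem_ker_right x' ha))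
  inner := Quotient.map₂ E.inner (by
    intro x x' hx y y' hy
    replace hx := (Submodule.quotientRel_def _).1 hx
    replace hy := (Submodule.quotientRel_def _).1 hy
    refine (Submodule.quotientRel_def p.ker).2 ?_
    have h1 : E.inner x y - E.inner x' y' = E.inner (x - x') y + E.inner x' (y - y') := by
      rw [E.inner_sub_left, E.inner_sub_right]; abel
    rw [h1]
    exact add_mem (E.inner_eq_zero_left (E.mem_ker.1 hx) _)
      (E.inner_eq_zero_right (E.mem_ker.1 hy) _))
  add_act := by
    rintro ⟨x⟩ ⟨y⟩ ⟨a⟩; exact congrArg (E.ker p).mkQ (E.add_act x y a)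
  act_add := by
    rintro ⟨x⟩ ⟨a⟩ ⟨b⟩; exact congrArg (E.ker p).mkQ (E.act_add x a b)
  act_mul := by
    rintro ⟨x⟩ ⟨a⟩ ⟨b⟩; exact congrArg (E.ker p).mkQ (E.act_mul x a b)
  smul_act := by
    rintro c ⟨x⟩ ⟨a⟩; exact congrArg (E.ker p).mkQ (E.smul_act c x a)
  act_smul := by
    rintro c ⟨x⟩ ⟨a⟩; exact congrArg (E.ker p).mkQ (E.act_smul c x a)
  inner_add_right := by
    rintro ⟨x⟩ ⟨y⟩ ⟨z⟩; exact congrArg p.proj (E.inner_add_right x y z)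
  inner_smul_right := by
    rintro c ⟨x⟩ ⟨y⟩; exact congrArg p.proj (E.inner_smul_right c x y)
  inner_act_right := by
    rintro ⟨x⟩ ⟨y⟩ ⟨a⟩; exact congrArg p.proj (E.inner_act_right x y a)
  star_inner := by
    rintro ⟨x⟩ ⟨y⟩; exact congrArg p.proj (E.star_inner x y)
  inner_self_nonneg := by
    rintro ⟨x⟩
    obtain ⟨b, hb⟩ := E.inner_self_nonneg x
    exact ⟨p.proj b, congrArg p.proj hb⟩
  inner_self_eq_zero := by
    rintro ⟨x⟩
    exact p.proj_eq_zero.trans (E.mem_ker.symm.trans (Submodule.Quotient.mk_eq_zero _).symm)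

theorem quot_inner_mk (p : CStarSeminorm A) (x y : X) :
    (E.quot p).inner ((E.ker p).mkQ x) ((E.ker p).mkQ y) = p.proj (E.inner x y) := rfl

theorem quot_act_mk (p : CStarSeminorm A) (x : X) (a : A) :
    (E.quot p).act ((E.ker p).mkQ x) (p.proj a) = (E.ker p).mkQ (E.act x a) := rfl

/-! ### Adjointable operators -/

/-- `S` is a module morphism that is an adjoint of `T`. -/
def IsAdjoint (T S : Module.End ℂ X) : Prop :=
  (∀ x a, S (E.act x a) = E.act (S x) a) ∧ ∀ x y, E.inner (T x) y = E.inner x (S y)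

/-- The algebra of adjointable module morphisms `X → X`. -/
def adjointables : Subalgebra ℂ (Module.End ℂ X) where
  carrier := {T | (∀ x a, T (E.act x a) = E.act (T x) a) ∧ ∃ S, E.IsAdjoint T S}
  mul_mem' := by
    rintro T T' ⟨hT, S, hS, h⟩ ⟨hT', S', hS', h'⟩
    exact ⟨fun x a => by simp only [Module.End.mul_apply, hT, hT'], S' * S,
      fun x a => by simp only [Module.End.mul_apply, hS, hS'],
      fun x y => by simp only [Module.End.mul_apply, h, h']⟩
  add_mem' := by
    rintro T T' ⟨hT, S, hS, h⟩ ⟨hT', S', hS', h'⟩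
    exact ⟨fun x a => by simp only [LinearMap.add_apply, hT, hT', E.add_act], S + S',
      fun x a => by simp only [LinearMap.add_apply, hS, hS', E.add_act],
      fun x y => by
        simp only [LinearMap.add_apply, h, h', E.inner_add_left, E.inner_add_right]⟩
  algebraMap_mem' := by
    intro c
    refine ⟨fun x a => ?_, algebraMap ℂ _ (star c), fun x a => ?_, fun x y => ?_⟩
    · simp only [Module.algebraMap_end_apply, E.smul_act]
    · simp only [Module.algebraMap_end_apply, E.smul_act]
    · simp only [Module.algebraMap_end_apply, E.inner_smul_left, E.inner_smul_right]

theorem IsAdjoint.unique {T S S' : Module.End ℂ X} (h : E.IsAdjoint T S)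
    (h' : E.IsAdjoint T S') : S = S' :=
  LinearMap.ext fun x => E.ext_inner fun z => by rw [← h.2, ← h'.2]

theorem IsAdjoint.symm {T S : Module.End ℂ X} (hT : ∀ x a, T (E.act x a) = E.act (T x) a)
    (h : E.IsAdjoint T S) : E.IsAdjoint S T :=
  ⟨hT, fun x y => by rw [← E.star_inner, ← h.2, E.star_inner]⟩

/-- `L_A(X)`, the star algebra of adjointable module morphisms of `X`, considered with the
topology defined by the seminorms that belong to the family `p` of C*-seminorms of `A`. -/
def Adj {Λ : Type w} (_p : Λ → CStarSeminorm A) : Type v := E.adjointables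

variable {Λ : Type w} (p : Λ → CStarSeminorm A)

instance : Ring (E.Adj p) := inferInstanceAs (Ring E.adjointables)

instance : Algebra ℂ (E.Adj p) := inferInstanceAs (Algebra ℂ E.adjointables)

instance : CoeFun (E.Adj p) (fun _ => X → X) := ⟨fun T => (T.1 : Module.End ℂ X)⟩

/-- The adjoint `T*`. -/
instance : Star (E.Adj p) :=
  ⟨fun T => ⟨T.2.2.choose, T.2.2.choose_spec.1, T.1,
    IsAdjoint.symm E T.2.1 T.2.2.choose_spec⟩⟩

theorem isAdjoint_star (T : E.Adj p) : E.IsAdjoint T.1 (star T : E.Adj p).1 :=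
  T.2.2.choose_spec

theorem star_eq_of_isAdjoint {T S : E.Adj p} (h : E.IsAdjoint T.1 S.1) : star T = S :=
  Subtype.ext (IsAdjoint.unique E (E.isAdjoint_star p T) h)

instance : StarRing (E.Adj p) where
  star_involutive T :=
    E.star_eq_of_isAdjoint p (IsAdjoint.symm E T.2.1 (E.isAdjoint_star p T))
  star_mul T S := E.star_eq_of_isAdjoint p ⟨(star S * star T : E.Adj p).2.1, fun x y => by
    change E.inner (T.1 (S.1 x)) y = E.inner x ((star S : E.Adj p).1 ((star T : E.Adj p).1 y))
    rw [(E.isAdjoint_star p T).2, (E.isAdjoint_star p S).2]⟩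
  star_add T S := E.star_eq_of_isAdjoint p ⟨(star T + star S : E.Adj p).2.1, fun x y => by
    change E.inner (T.1 x + S.1 x) y
      = E.inner x ((star T : E.Adj p).1 y + (star S : E.Adj p).1 y)
    rw [E.inner_add_left, E.inner_add_right, (E.isAdjoint_star p T).2,
      (E.isAdjoint_star p S).2]⟩

instance : StarModule ℂ (E.Adj p) where
  star_smul c T := E.star_eq_of_isAdjoint p ⟨(star c • star T : E.Adj p).2.1, fun x y => by
    change E.inner (c • T.1 x) y = E.inner x (star c • (star T : E.Adj p).1 y)
    rw [E.inner_smul_left, E.inner_smul_right, (E.isAdjoint_star p T).2]⟩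

/-- `p_{i, L_A(X)}(T) = sup {p_i^A(T x) | p_i^A(x) ≤ 1}`, as an extended nonnegative number
(so that no default value can occur for the supremum). -/
def opNorm (i : Λ) (T : E.Adj p) : ℝ≥0∞ :=
  ⨆ (x : X) (_ : E.seminorm (p i) x ≤ 1), ENNReal.ofReal (E.seminorm (p i) (T x))

/-- The topology of `L_A(X)`. -/
instance : TopologicalSpace (E.Adj p) := seminormTopology (E.opNorm p)

/-- The operator `θ_{y,x} z = y⟨x, z⟩`. -/
def theta (y x : X) : E.Adj p :=
  ⟨{ toFun := fun z => E.act y (E.inner x z)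
     map_add' := fun z w => by rw [E.inner_add_right, E.act_add]
     map_smul' := fun c z => by rw [E.inner_smul_right, E.act_smul, RingHom.id_apply] },
   fun z a => by
    change E.act y (E.inner x (E.act z a)) = E.act (E.act y (E.inner x z)) a
    rw [E.inner_act_right, E.act_mul],
   { toFun := fun z => E.act x (E.inner y z)
     map_add' := fun z w => by rw [E.inner_add_right, E.act_add]
     map_smul' := fun c z => by rw [E.inner_smul_right, E.act_smul, RingHom.id_apply] },
   fun z a => by
    change E.act x (E.inner y (E.act z a)) = E.act (E.act x (E.inner y z)) a
    rw [E.inner_act_right, E.act_mul],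
   fun z w => by
    change E.inner (E.act y (E.inner x z)) w = E.inner z (E.act x (E.inner y w))
    rw [E.inner_act_left, E.inner_act_right, E.star_inner]⟩

/-- `K_A(X)`, the closure in `L_A(X)` of the linear span of the operators `θ_{y,x}`. -/
def compacts : Set (E.Adj p) :=
  closure (Submodule.span ℂ {T | ∃ y x : X, T = E.theta p y x} : Set (E.Adj p))

theorem apply_mem_ker (T : E.Adj p) (i : Λ) {x : X} (hx : x ∈ E.ker (p i)) :
    T.1 x ∈ E.ker (p i) := by
  rw [E.mem_ker, (E.isAdjoint_star p T).2]
  exact E.inner_eq_zero_left (E.mem_ker.1 hx) _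

/-- The C*-algebra `L_{A_i}(X_i)` that belongs to the `i`-th seminorm. -/
abbrev QuotAdj (i : Λ) : Type v := (E.quot (p i)).Adj (fun _ : Unit => (p i).quotNorm)

/-- The ideal `K_{A_i}(X_i)` of `L_{A_i}(X_i)`. -/
abbrev quotCompacts (i : Λ) : Set (E.QuotAdj p i) :=
  (E.quot (p i)).compacts (fun _ : Unit => (p i).quotNorm)

/-- The operator that `T` induces on `X_i`. -/
def inducedEnd (i : Λ) (T : E.Adj p) : Module.End ℂ (X ⧸ E.ker (p i)) :=
  (E.ker (p i)).mapQ (E.ker (p i)) T.1 fun _ hx => E.apply_mem_ker p T i hx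

/-- The canonical map `L_A(X) → L_{A_i}(X_i)`, `T ↦ (x + N_i ↦ T x + N_i)`. -/
def adjProj (i : Λ) (T : E.Adj p) : E.QuotAdj p i :=
  ⟨E.inducedEnd p i T, by
    rintro ⟨x⟩ ⟨a⟩; exact congrArg (E.ker (p i)).mkQ (T.2.1 x a),
    E.inducedEnd p i (star T), by
      rintro ⟨x⟩ ⟨a⟩; exact congrArg (E.ker (p i)).mkQ ((star T : E.Adj p).2.1 x a), by
    rintro ⟨x⟩ ⟨y⟩; exact congrArg (p i).proj ((E.isAdjoint_star p T).2 x y)⟩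

theorem adjProj_apply (i : Λ) (T : E.Adj p) (x : X) :
    (E.adjProj p i T) ((E.ker (p i)).mkQ x) = (E.ker (p i)).mkQ (T x) := rfl

end InnerModule

/-! ### Hilbert pro-C*-modules, bimodules and correspondences -/

variable {Λ : Type w}

/-- A right Hilbert pro-C*-module over the pro-C*-algebra `A` with C*-seminorms `p`. -/
structure HilbertProModule (p : Λ → CStarSeminorm A) (X : Type v) [AddCommGroup X]
    [Module ℂ X] extends InnerModule A X where
  complete : IsSeminormComplete fun i => toInnerModule.seminorm (p i)

/-- A left Hilbert pro-C*-module over the pro-C*-algebra `A` with C*-seminorms `p`; the inner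
product is linear in the first variable. -/
structure LeftHilbertProModule (p : Λ → CStarSeminorm A) (X : Type v) [AddCommGroup X]
    [Module ℂ X] where
  /-- the left action `a x` -/
  act : A → X → X
  act_add : ∀ a x y, act a (x + y) = act a x + act a y
  add_act : ∀ a b x, act (a + b) x = act a x + act b x
  mul_act : ∀ a b x, act (a * b) x = act a (act b x)
  act_smul : ∀ (c : ℂ) a x, act a (c • x) = c • act a x
  smul_act : ∀ (c : ℂ) a x, act (c • a) x = c • act a x
  /-- the left inner product -/
  inner : X → X → A
  inner_add_left : ∀ x y z, inner (x + y) z = inner x z + inner y z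
  inner_smul_left : ∀ (c : ℂ) x y, inner (c • x) y = c • inner x y
  inner_act_left : ∀ a x y, inner (act a x) y = a * inner x y
  star_inner : ∀ x y, star (inner x y) = inner y x
  inner_self_nonneg : ∀ x, ∃ b, inner x x = star b * b
  inner_self_eq_zero : ∀ x, inner x x = 0 ↔ x = 0
  complete : IsSeminormComplete fun i x => √(p i (inner x x))

/-- The seminorm `x ↦ p(⟨x, x⟩)^(1/2)` of the left inner product. -/
def LeftHilbertProModule.seminorm {p : Λ → CStarSeminorm A} (M : LeftHilbertProModule p X)
    (i : Λ) (x : X) : ℝ := √(p i (M.inner x x))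

/-- A Hilbert `A`-`B` pro-C*-bimodule: a left Hilbert pro-C*-module over `A` and a right Hilbert
pro-C*-module over `B` on the same space `X`, with the compatibility relations. -/
structure HilbertProBimodule {B : Type u'} [NonUnitalRing B] [StarRing B] [Module ℂ B]
    (p : Λ → CStarSeminorm A) (q : Λ → CStarSeminorm B) (X : Type v) [AddCommGroup X]
    [Module ℂ X] where
  left : LeftHilbertProModule p X
  right : HilbertProModule q X
  inner_act : ∀ x y z, left.act (left.inner x y) z = right.act x (right.inner y z)
  seminorm_left_act : ∀ i a x,
    right.seminorm (q i) (left.act a x) ≤ p i a * right.seminorm (q i) x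
  seminorm_right_act : ∀ i b x,
    left.seminorm i (right.act x b) ≤ q i b * left.seminorm i x

variable [IsScalarTower ℂ A A] [SMulCommClass ℂ A A] [StarModule ℂ A]

/-- The ideal `J_X^i`: all `a` in `A` such that `φ(a)` induces an element of `K_{A_i}(X_i)` and
`ab` vanishes in `A_i` for every `b` in the kernel of `A → L_A(X) → L_{A_i}(X_i)`. -/
def katsuraIdealAt {p : Λ → CStarSeminorm A} (E : InnerModule A X) (φ : A →⋆ₙₐ[ℂ] E.Adj p)
    (i : Λ) : Set A :=
  {a | E.adjProj p i (φ a) ∈ E.quotCompacts p i ∧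
    ∀ b, E.adjProj p i (φ b) = 0 → (p i).proj (a * b) = 0}

/-- The ideal `𝒥_X`, the intersection of the ideals `J_X^i`. -/
def katsuraIdeal {p : Λ → CStarSeminorm A} (E : InnerModule A X) (φ : A →⋆ₙₐ[ℂ] E.Adj p) :
    Set A := ⋂ i, katsuraIdealAt E φ i

end InnerModule

end ProCStar

end

/-! Write `φ` for the left action and `J` for `katsuraIdeal`. The link between the two sides is the
relation `φ (L x y) = θ_{x,y}`, where `L` is the left inner product. It is the bimodule
compatibility relation when a bimodule is given, and it defines `L` when only `φ` is given.

From a bimodule to the isometry: the left seminorms are dominated by the right ones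
(`left_seminorm_le`). Hence if `φ b` vanishes at level `i`, then `⟨x, y⟩ b = ⟨x, b* y⟩` vanishes at
level `i`, so the span of the left inner products annihilates the kernel of `φ` at every level
(`span_inner_le`). A C*-algebraic fact (`eq_of_mul_ker_eq_zero`, proved by functional calculus) says
that a morphism preserves the norm of any element annihilating its kernel. So `φ` is isometric at
each level both on this span and on `J`. The span is mapped onto the finite-rank operators.
Completeness of `A` lifts limits of finite-rank operators to elements of `J`, and isometry with
directedness shows that `J` is mapped into `K_A(X)`. An isometric bijection that is continuous is a
homeomorphism.

From the isometry to a bimodule: let `L x y` be the unique element of `J` with `φ (L x y) =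
θ_{x,y}`. Since `J` is a `*`-closed left ideal, the algebraic identities hold because they hold
after applying `φ`. Isometry gives `p_i (L x x) = p_i ⟨x, x⟩`, so the left and right seminorms
coincide. This yields definiteness, completeness and both norm inequalities. The delicate point is
that `L x x` is positive in `A` (`exists_eq_star_mul_self`): `φ` is injective only on `J`, and
compressing `L x x` by its negative part stays inside `J`. -/

set_option linter.unusedSectionVars false

noncomputable section

namespace ProCStar

/-! ### Topologies defined by extended real valued seminorms -/

section SeminormTopology

variable {ι V : Type*} [AddCommGroup V] {q : ι → V → ℝ≥0∞}

theorem isOpen_seminormTopology_ball (hadd : ∀ i x y, q i (x + y) ≤ q i x + q i y)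
    (s : Finset ι) (x : V) (ε : ℝ≥0∞) :
    IsOpen[seminormTopology q] {y | ∀ i ∈ s, q i (y - x) < ε} := by
  let _ : TopologicalSpace V := seminormTopology q
  have h : ∀ i, IsOpen {y | q i (y - x) < ε} := by
    intro i y hy
    refine ⟨{i}, ε - q i (y - x), tsub_pos_of_lt hy, fun z hz => ?_⟩
    have h1 := hz i (Finset.mem_singleton_self i)
    have h2 := hadd i (z - y) (y - x)
    rw [sub_add_sub_cancel] at h2
    exact h2.trans_lt (lt_tsub_iff_right.1 h1)
  have h2 : {y | ∀ i ∈ s, q i (y - x) < ε} = ⋂ i ∈ s, {y | q i (y - x) < ε} := by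
    ext y; simp
  rw [h2]
  exact isOpen_biInter_finset fun i _ => h i

theorem mem_closure_seminormTopology (h0 : ∀ i, q i 0 = 0)
    (hadd : ∀ i x y, q i (x + y) ≤ q i x + q i y) {S : Set V} {x : V} :
    x ∈ @closure V (seminormTopology q) S ↔
      ∀ (s : Finset ι) (ε : ℝ≥0∞), 0 < ε → ∃ y ∈ S, ∀ i ∈ s, q i (y - x) < ε := by
  let _ : TopologicalSpace V := seminormTopology q
  rw [mem_closure_iff]
  constructor
  · intro h s ε hε
    obtain ⟨y, hy, hyS⟩ := h _ (isOpen_seminormTopology_ball hadd s x ε)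
      (fun i _ => by rwa [sub_self, h0])
    exact ⟨y, hyS, hy⟩
  · intro h U hU hx
    obtain ⟨s, ε, hε, hs⟩ := hU x hx
    obtain ⟨y, hy, h'⟩ := h s ε hε
    exact ⟨y, hs y h', hy⟩

theorem eventually_nhds_seminormTopology (h0 : ∀ i, q i 0 = 0)
    (hadd : ∀ i x y, q i (x + y) ≤ q i x + q i y) (x : V) (i : ι) {ε : ℝ≥0∞} (hε : 0 < ε) :
    ∀ᶠ y in @nhds V (seminormTopology q) x, q i (y - x) < ε := by
  let _ : TopologicalSpace V := seminormTopology q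
  refine Filter.mem_of_superset
    (IsOpen.mem_nhds (isOpen_seminormTopology_ball hadd {i} x ε) ?_) ?_
  · intro j _; rwa [sub_self, h0]
  · intro y hy; exact hy i (Finset.mem_singleton_self i)

end SeminormTopology

/-! ### Completeness, separation and directedness of a pro-C*-algebra -/

namespace IsProCStarAlgebra

variable {A : Type u} [NonUnitalRing A] [StarRing A] [Module ℂ A] [UniformSpace A]
  {Λ : Type w} {p : Λ → CStarSeminorm A}

theorem isSeminormComplete (hA : IsProCStarAlgebra p) :
    IsSeminormComplete fun i => (p i : A → ℝ) := by
  intro F hF h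
  have := hA.isUniformAddGroup
  have := hA.completeSpace
  have hc : Cauchy F := by
    refine ⟨hF, ?_⟩
    rw [uniformity_eq_comap_nhds_zero A, ← Filter.tendsto_iff_comap]
    rw [hA.withSeminorms.tendsto_nhds]
    intro i ε hε
    obtain ⟨s, hs, h'⟩ := h i ε hε
    filter_upwards [Filter.prod_mem_prod hs hs] with x hx
    rw [sub_zero]
    exact h' _ hx.2 _ hx.1
  obtain ⟨x, hx⟩ := CompleteSpace.complete hc
  refine ⟨x, fun i => ?_⟩
  rw [Metric.tendsto_nhds]
  intro ε hε
  have h2 := (hA.withSeminorms.tendsto_nhds id x).1 hx i ε hε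
  filter_upwards [h2] with y hy
  rw [Real.dist_eq, sub_zero, abs_of_nonneg (apply_nonneg _ _)]
  exact hy

theorem ext (hA : IsProCStarAlgebra p) {a b : A} (h : ∀ i, p i (a - b) = 0) : a = b := by
  have := hA.t2Space
  by_contra hab
  obtain ⟨i, hi⟩ := hA.withSeminorms.separating_of_T1 (a - b) (sub_ne_zero.2 hab)
  exact hi (h i)

theorem exists_forall_le (hA : IsProCStarAlgebra p) {s : Finset Λ} (hs : s.Nonempty) :
    ∃ j, ∀ i ∈ s, ∀ a, p i a ≤ p j a := by
  have : Nonempty Λ := ⟨hs.choose⟩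
  obtain ⟨j, hj⟩ := hA.directed.finset_le s
  exact ⟨j, fun i hi a => hj i hi a⟩

end IsProCStarAlgebra

/-! ### Functional calculus and norms of elements that annihilate a kernel -/

section FunctionalCalculus

variable {A : Type u} [NonUnitalRing A] [StarRing A] [Module ℂ A]

/-- `A` has no unit, but a polynomial without constant term can be evaluated in it. The point is
that one element `c` serves for all morphisms into C*-algebras at once. -/
theorem exists_map_eq_aeval (h : A) (P : Polynomial ℝ) (hP : P.eval 0 = 0) :
    ∃ c : A, ∀ (D : Type u) [CStarAlgebra D] (f : A →⋆ₙₐ[ℂ] D),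
      f c = Polynomial.aeval (f h) P := by
  have hpow : ∀ n : ℕ, ∃ c : A, ∀ (D : Type u) [CStarAlgebra D] (f : A →⋆ₙₐ[ℂ] D),
      f c = f h ^ (n + 1) := by
    intro n
    induction n with
    | zero => exact ⟨h, fun D _ f => by simp⟩
    | succ n ih =>
      obtain ⟨c, hc⟩ := ih
      exact ⟨c * h, fun D _ f => by rw [map_mul, hc, ← pow_succ]⟩
  have key : ∀ Q : Polynomial ℝ, ∃ c : A, ∀ (D : Type u) [CStarAlgebra D] (f : A →⋆ₙₐ[ℂ] D),
      f c = Polynomial.aeval (f h) (Polynomial.X * Q) := by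
    intro Q
    induction Q using Polynomial.induction_on' with
    | add Q R hQ hR =>
      obtain ⟨c, hc⟩ := hQ
      obtain ⟨d, hd⟩ := hR
      exact ⟨c + d, fun D _ f => by rw [map_add, hc, hd, mul_add, map_add]⟩
    | monomial n r =>
      obtain ⟨c, hc⟩ := hpow n
      refine ⟨(r : ℂ) • c, fun D _ f => ?_⟩
      rw [map_smul, hc, Polynomial.X_mul_monomial, Polynomial.aeval_monomial,
        ← Algebra.smul_def, Complex.coe_smul]
  obtain ⟨Q, rfl⟩ : Polynomial.X ∣ P := by
    rw [Polynomial.X_dvd_iff, Polynomial.coeff_zero_eq_eval_zero, hP]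
  exact key Q

/-- The interval grows with `n` because `h` may have unbounded seminorms `p i h`: every single
spectrum is eventually covered. Weierstrass is applied with half the tolerance, and the other half
pays for removing the constant term. -/
theorem exists_polynomial_sub_le {g : ℝ → ℝ} (hg : Continuous g) (hg0 : g 0 = 0) (n : ℕ) :
    ∃ P : Polynomial ℝ, P.eval 0 = 0 ∧
      ∀ t : ℝ, |t| ≤ n → |P.eval t - g t| ≤ 1 / ((n : ℝ) + 1) := by
  obtain ⟨Q, hQ⟩ := exists_polynomial_near_of_continuousOn (-(n : ℝ)) n g hg.continuousOn
    (1 / ((n : ℝ) + 1) / 2) (by positivity)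
  refine ⟨Q - Polynomial.C (Q.eval 0), by simp, fun t ht => ?_⟩
  have h1 := hQ t (abs_le.1 ht)
  have h2 := hQ 0 (by simp)
  rw [hg0, sub_zero] at h2
  rw [Polynomial.eval_sub, Polynomial.eval_C]
  rw [abs_lt] at h1 h2
  rw [abs_le]
  constructor <;> linarith [h1.1, h1.2, h2.1, h2.2]

variable [UniformSpace A] [IsScalarTower ℂ A A] [SMulCommClass ℂ A A] [StarModule ℂ A]
  {Λ : Type w} {p : Λ → CStarSeminorm A}

/-- The continuous functional calculus of a self-adjoint element of a pro-C*-algebra, for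
functions that vanish at `0`. -/
theorem IsProCStarAlgebra.exists_cfc (hA : IsProCStarAlgebra p) {h : A} (hh : star h = h)
    {g : ℝ → ℝ} (hg : Continuous g) (hg0 : g 0 = 0) :
    ∃ b : A, ∀ (D : Type u) [CStarAlgebra D] (f : A →⋆ₙₐ[ℂ] D) (i : Λ),
      (∀ a, ‖f a‖ ≤ p i a) → f b = cfc g (f h) := by
  choose P hP0 hP using exists_polynomial_sub_le hg hg0
  choose c hc using fun n => exists_map_eq_aeval h (P n) (hP0 n)
  have hsa : ∀ (D : Type u) [CStarAlgebra D] (f : A →⋆ₙₐ[ℂ] D), IsSelfAdjoint (f h) := by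
    intro D _ f
    rw [IsSelfAdjoint, ← map_star, hh]
  have hlim : ∀ (D : Type u) [CStarAlgebra D] (f : A →⋆ₙₐ[ℂ] D),
      Tendsto (fun n => f (c n)) atTop (𝓝 (cfc g (f h))) := by
    intro D _ f
    have hs := hsa D f
    rw [tendsto_iff_norm_sub_tendsto_zero]
    refine squeeze_zero' (Eventually.of_forall fun n => norm_nonneg _) ?_
      tendsto_one_div_add_atTop_nhds_zero_nat
    -- The factor `‖1‖` makes the spectral bound valid also when `D` is trivial.
    obtain ⟨N, hN⟩ := exists_nat_ge (‖f h‖ * ‖(1 : D)‖)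
    filter_upwards [eventually_ge_atTop N] with n hn
    rw [hc, ← cfc_polynomial (P n) (f h) hs, ← cfc_sub _ _ _ (by fun_prop) (by fun_prop)]
    refine norm_cfc_le (by positivity) fun t ht => hP n t ?_
    have h1 := spectrum.norm_le_norm_mul_of_mem ht
    rw [Real.norm_eq_abs] at h1
    exact h1.trans (hN.trans (by exact_mod_cast hn))
  -- The approximants converge in a C*-algebra realising each `p i`, so they are Cauchy for every `p
  -- i` and have a common limit `b` in `A`.
  obtain ⟨b, hb⟩ := hA.isSeminormComplete (Filter.map c atTop) inferInstance (by
    intro i ε hε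
    obtain ⟨D, _, f, hf⟩ := (p i).exists_cstarAlgebra
    obtain ⟨N, hN⟩ := Metric.cauchySeq_iff.1 (hlim D f).cauchySeq ε hε
    refine ⟨c '' Set.Ici N, Filter.image_mem_map (Filter.Ici_mem_atTop N), ?_⟩
    rintro _ ⟨m, hm, rfl⟩ _ ⟨n, hn, rfl⟩
    have := hN m hm n hn
    rwa [dist_eq_norm, ← map_sub, hf] at this)
  refine ⟨b, fun D _ f i hf => ?_⟩
  refine tendsto_nhds_unique ?_ (hlim D f)
  rw [tendsto_iff_norm_sub_tendsto_zero]
  refine squeeze_zero (fun n => norm_nonneg _) (fun n => ?_) (Filter.tendsto_map'_iff.1 (hb i))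
  rw [← map_sub]
  exact hf _

/-- Let `q ≤ p i` be a C*-seminorm. An element `a` that annihilates the kernel of `q` modulo the
kernel of `p i` has the same norm for both seminorms. -/
theorem IsProCStarAlgebra.eq_of_mul_ker_eq_zero (hA : IsProCStarAlgebra p) {i : Λ}
    {q : CStarSeminorm A} (hq : ∀ a, q a ≤ p i a) {a : A}
    (ha : ∀ b, q b = 0 → p i (a * b) = 0) : p i a = q a := by
  refine le_antisymm ?_ (hq a)
  set h := star a * a with hdef
  have hh : star h = h := by rw [hdef, star_mul, star_star]
  have hqh : 0 ≤ q h := apply_nonneg q.toSeminorm h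
  -- `b = (|h| - q(h))₊` measures how far the spectrum of `h` at level `i` exceeds the bound `q h`.
  -- It is killed by `q`, where the spectrum lies in `[-q h, q h]`.
  obtain ⟨b, hb⟩ := hA.exists_cfc hh (g := fun t => max (|t| - q h) 0) (by fun_prop)
    (by simp [hqh])
  obtain ⟨D, _, f, hf⟩ := q.exists_cstarAlgebra
  obtain ⟨D', _, f', hf'⟩ := (p i).exists_cstarAlgebra
  have hqb : q b = 0 := by
    rcases subsingleton_or_nontrivial D with hD | hD
    · rw [← hf, Subsingleton.elim (f b) 0, norm_zero]
    rw [← hf, hb D f i fun a => (hf a).trans_le (hq a), norm_eq_zero, ← cfc_zero ℝ (f h)]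
    refine cfc_congr fun t ht => ?_
    have h1 := spectrum.norm_le_norm_of_mem ht
    rw [hf, Real.norm_eq_abs] at h1
    simp [h1]
  have hpb : p i (h * b) = 0 := by
    refine le_antisymm ?_ (apply_nonneg (p i).toSeminorm _)
    rw [hdef, mul_assoc]
    refine ((p i).mul_le _ _).trans ?_
    rw [ha b hqb, mul_zero]
  have hs : IsSelfAdjoint (f' h) := by rw [IsSelfAdjoint, ← map_star, hh]
  have hph : p i h ≤ q h := by
    rw [← hf'] at hpb ⊢
    rw [norm_eq_zero, map_mul, hb D' f' i fun a => (hf' a).le] at hpb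
    nth_rewrite 1 [← cfc_id' ℝ (f' h)] at hpb
    rw [← cfc_mul _ _ _ (by fun_prop) (by fun_prop)] at hpb
    rw [← cfc_id' ℝ (f' h)]
    -- Since `h b = 0` at level `i`, each spectral value satisfies `t (|t| - q h)₊ = 0`, hence `|t|
    -- ≤ q h`.
    refine norm_cfc_le hqh fun t ht => ?_
    have h1 := norm_apply_le_norm_cfc (fun t => t * max (|t| - q h) 0) (f' h) ht (by fun_prop) hs
    rw [hpb, norm_zero, norm_le_zero_iff] at h1
    rw [Real.norm_eq_abs]
    rcases mul_eq_zero.1 h1 with h2 | h2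
    · rw [h2, abs_zero]; exact hqh
    · linarith [le_max_left (|t| - q h) 0]
  rw [hdef, (p i).star_mul_self, q.star_mul_self] at hph
  exact (pow_le_pow_iff_left₀ (apply_nonneg (p i).toSeminorm a)
    (apply_nonneg q.toSeminorm a) two_ne_zero).1 hph

end FunctionalCalculus

/-! ### Seminorms on inner product modules and on adjointable operators -/

namespace CStarSeminorm

variable {A : Type u} [NonUnitalRing A] [StarRing A] [Module ℂ A]

theorem nonneg (p : CStarSeminorm A) (a : A) : 0 ≤ p a := apply_nonneg p.toSeminorm a

theorem apply_zero (p : CStarSeminorm A) : p 0 = 0 := map_zero p.toSeminorm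

theorem add_le (p : CStarSeminorm A) (a b : A) : p (a + b) ≤ p a + p b :=
  map_add_le_add p.toSeminorm a b

theorem smul_eq (p : CStarSeminorm A) (c : ℂ) (a : A) : p (c • a) = ‖c‖ * p a :=
  map_smul_eq_mul p.toSeminorm c a

theorem abs_sub_le (p : CStarSeminorm A) (a b : A) : |p a - p b| ≤ p (a - b) :=
  abs_sub_map_le_sub p.toSeminorm a b

end CStarSeminorm

namespace InnerModule

variable {A : Type u} [NonUnitalRing A] [StarRing A] [Module ℂ A]
  {X : Type v} [AddCommGroup X] [Module ℂ X] (E : InnerModule A X)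

section

variable (r : CStarSeminorm A)

theorem seminorm_nonneg (x : X) : 0 ≤ E.seminorm r x := Real.sqrt_nonneg _

theorem seminorm_sq (x : X) : E.seminorm r x ^ 2 = r (E.inner x x) :=
  Real.sq_sqrt (r.nonneg _)

theorem seminorm_act_le (x : X) (a : A) :
    E.seminorm r (E.act x a) ≤ r a * E.seminorm r x := by
  refine (pow_le_pow_iff_left₀ (E.seminorm_nonneg r _)
    (mul_nonneg (r.nonneg a) (E.seminorm_nonneg r _)) two_ne_zero).1 ?_
  rw [mul_pow, E.seminorm_sq, E.seminorm_sq, E.inner_act_right, E.inner_act_left]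
  calc r (star a * E.inner x x * a) ≤ r (star a) * r (E.inner x x) * r a :=
        (r.mul_le _ _).trans (mul_le_mul_of_nonneg_right (r.mul_le _ _) (r.nonneg a))
    _ = _ := by rw [r.star_eq]; ring

variable [IsScalarTower ℂ A A] [SMulCommClass ℂ A A] [StarModule ℂ A]

theorem inner_le (x y : X) : r (E.inner x y) ≤ E.seminorm r x * E.seminorm r y := by
  refine (pow_le_pow_iff_left₀ (r.nonneg _)
    (mul_nonneg (E.seminorm_nonneg r _) (E.seminorm_nonneg r _)) two_ne_zero).1 ?_
  rw [mul_pow, E.seminorm_sq, E.seminorm_sq]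
  exact E.cauchySchwarz r x y

theorem seminorm_smul (c : ℂ) (x : X) : E.seminorm r (c • x) = ‖c‖ * E.seminorm r x := by
  refine (pow_left_inj₀ (E.seminorm_nonneg r _)
    (mul_nonneg (norm_nonneg c) (E.seminorm_nonneg r _)) two_ne_zero).1 ?_
  rw [mul_pow, E.seminorm_sq, E.seminorm_sq, E.inner_smul_left, E.inner_smul_right,
    r.smul_eq, r.smul_eq, norm_star]
  ring

theorem seminorm_add_le (x y : X) :
    E.seminorm r (x + y) ≤ E.seminorm r x + E.seminorm r y := by
  have hx := E.seminorm_nonneg r x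
  have hy := E.seminorm_nonneg r y
  refine (pow_le_pow_iff_left₀ (E.seminorm_nonneg r _) (add_nonneg hx hy) two_ne_zero).1 ?_
  rw [E.seminorm_sq, E.inner_add_left, E.inner_add_right, E.inner_add_right]
  have h1 := E.inner_le r x x
  have h2 := E.inner_le r x y
  have h3 := E.inner_le r y x
  have h4 := E.inner_le r y y
  have h5 := r.add_le (E.inner x x + E.inner x y) (E.inner y x + E.inner y y)
  have h6 := r.add_le (E.inner x x) (E.inner x y)
  have h7 := r.add_le (E.inner y x) (E.inner y y)
  nlinarith

end

variable [IsScalarTower ℂ A A] [SMulCommClass ℂ A A] [StarModule ℂ A]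
  {Λ : Type w} (p : Λ → CStarSeminorm A) (i : Λ)

/-- Vectors of positive seminorm are normalised. Null vectors cannot be, and there the bound holds
because an adjointable operator preserves the kernel of the seminorm. -/
theorem opNorm_le_ofReal {T : E.Adj p} {C : ℝ} (hC : 0 ≤ C) :
    E.opNorm p i T ≤ ENNReal.ofReal C ↔
      ∀ x, E.seminorm (p i) (T x) ≤ C * E.seminorm (p i) x := by
  simp only [opNorm, iSup_le_iff, ENNReal.ofReal_le_ofReal_iff hC]
  constructor
  · intro h x
    rcases (E.seminorm_nonneg (p i) x).eq_or_lt with h0 | h0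
    · have h1 : E.seminorm (p i) (T x) = 0 := E.apply_mem_ker p T i (x := x) h0.symm
      rw [h1, ← h0, mul_zero]
    · set s := E.seminorm (p i) x
      have h1 := h (((s⁻¹ : ℝ) : ℂ) • x) (by
        rw [seminorm_smul, Complex.norm_real, Real.norm_of_nonneg (inv_nonneg.2 h0.le)]
        exact (inv_mul_cancel₀ h0.ne').le)
      rw [map_smul, seminorm_smul, Complex.norm_real,
        Real.norm_of_nonneg (inv_nonneg.2 h0.le), inv_mul_le_iff₀ h0] at h1
      linarith
  · intro h x hx
    exact (h x).trans (mul_le_of_le_one_right hC hx)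

theorem seminorm_apply_le {T : E.Adj p} (hT : E.opNorm p i T ≠ ⊤) (x : X) :
    E.seminorm (p i) (T x) ≤ (E.opNorm p i T).toReal * E.seminorm (p i) x :=
  (E.opNorm_le_ofReal p i ENNReal.toReal_nonneg).1 (ENNReal.ofReal_toReal hT).ge x

theorem opNorm_zero : E.opNorm p i 0 = 0 := by
  rw [← nonpos_iff_eq_zero, ← ENNReal.ofReal_zero, opNorm_le_ofReal _ _ _ le_rfl]
  intro x
  rw [zero_mul]
  exact ((E.ker (p i)).zero_mem : E.seminorm (p i) 0 = 0).le

theorem opNorm_add_le (T S : E.Adj p) :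
    E.opNorm p i (T + S) ≤ E.opNorm p i T + E.opNorm p i S := by
  rw [opNorm, iSup₂_le_iff]
  intro x hx
  calc ENNReal.ofReal (E.seminorm (p i) (T x + S x))
      ≤ ENNReal.ofReal (E.seminorm (p i) (T x) + E.seminorm (p i) (S x)) :=
        ENNReal.ofReal_le_ofReal (E.seminorm_add_le _ _ _)
    _ = ENNReal.ofReal (E.seminorm (p i) (T x)) + ENNReal.ofReal (E.seminorm (p i) (S x)) :=
        ENNReal.ofReal_add (E.seminorm_nonneg _ _) (E.seminorm_nonneg _ _)
    _ ≤ _ := add_le_add (le_iSup₂_of_le x hx le_rfl) (le_iSup₂_of_le x hx le_rfl)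

theorem opNorm_smul (c : ℂ) (T : E.Adj p) :
    E.opNorm p i (c • T) = ENNReal.ofReal ‖c‖ * E.opNorm p i T := by
  simp only [opNorm, ENNReal.mul_iSup]
  refine iSup_congr fun x => iSup_congr fun _ => ?_
  rw [← ENNReal.ofReal_mul (norm_nonneg c), ← seminorm_smul]
  rfl

theorem opNorm_sub_rev (T S : E.Adj p) : E.opNorm p i (T - S) = E.opNorm p i (S - T) := by
  have h := E.opNorm_smul p i (-1) (S - T)
  rw [norm_neg, norm_one, ENNReal.ofReal_one, one_mul, neg_one_smul, neg_sub] at h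
  exact h

theorem opNorm_mul_le (T S : E.Adj p) (hT : E.opNorm p i T ≠ ⊤) (hS : E.opNorm p i S ≠ ⊤) :
    E.opNorm p i (T * S) ≤ E.opNorm p i T * E.opNorm p i S := by
  rw [← ENNReal.ofReal_toReal hT, ← ENNReal.ofReal_toReal hS,
    ← ENNReal.ofReal_mul ENNReal.toReal_nonneg,
    opNorm_le_ofReal _ _ _ (mul_nonneg ENNReal.toReal_nonneg ENNReal.toReal_nonneg)]
  intro x
  have h1 := E.seminorm_apply_le p i hT (S x)
  have h2 := E.seminorm_apply_le p i hS x
  rw [mul_assoc]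
  exact h1.trans (mul_le_mul_of_nonneg_left h2 ENNReal.toReal_nonneg)

theorem opNorm_star (T : E.Adj p) : E.opNorm p i (star T) = E.opNorm p i T := by
  have key : ∀ T : E.Adj p, E.opNorm p i (star T) ≤ E.opNorm p i T := by
    intro T
    by_cases hT : E.opNorm p i T = ⊤
    · rw [hT]; exact le_top
    rw [← ENNReal.ofReal_toReal hT, opNorm_le_ofReal _ _ _ ENNReal.toReal_nonneg]
    intro x
    have h1 := E.seminorm_apply_le p i hT ((star T : E.Adj p) x)
    -- Cauchy–Schwarz for `⟨T*x, T*x⟩ = ⟨TT*x, x⟩`; one factor `‖T*x‖` then cancels.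
    have h2 : E.seminorm (p i) ((star T : E.Adj p) x) ^ 2
        ≤ E.seminorm (p i) (T ((star T : E.Adj p) x)) * E.seminorm (p i) x := by
      rw [E.seminorm_sq, ← (E.isAdjoint_star p T).2]
      exact E.inner_le _ _ _
    have h3 := E.seminorm_nonneg (p i) x
    rcases (E.seminorm_nonneg (p i) ((star T : E.Adj p) x)).eq_or_lt with h0 | h0
    · rw [← h0]; exact mul_nonneg ENNReal.toReal_nonneg h3
    · have h4 := mul_le_mul_of_nonneg_right h1 h3
      nlinarith
  refine le_antisymm (key T) ?_
  simpa using key (star T)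

theorem opNorm_sq_le_star_mul_self (T : E.Adj p) :
    E.opNorm p i T ^ 2 ≤ E.opNorm p i (star T * T) := by
  by_cases hT : E.opNorm p i (star T * T) = ⊤
  · rw [hT]; exact le_top
  have h1 : E.opNorm p i T ≤ ENNReal.ofReal √(E.opNorm p i (star T * T)).toReal := by
    rw [opNorm_le_ofReal _ _ _ (Real.sqrt_nonneg _)]
    intro x
    refine (pow_le_pow_iff_left₀ (E.seminorm_nonneg _ _)
      (mul_nonneg (Real.sqrt_nonneg _) (E.seminorm_nonneg _ _)) two_ne_zero).1 ?_
    rw [mul_pow, Real.sq_sqrt ENNReal.toReal_nonneg, E.seminorm_sq,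
      (E.isAdjoint_star p T).2]
    refine (E.inner_le _ _ _).trans ?_
    have h2 := mul_le_mul_of_nonneg_left (E.seminorm_apply_le p i hT x)
      (E.seminorm_nonneg (p i) x)
    refine h2.trans_eq ?_
    ring
  calc E.opNorm p i T ^ 2 ≤ ENNReal.ofReal √(E.opNorm p i (star T * T)).toReal ^ 2 := by
        gcongr
    _ = _ := by
        rw [← ENNReal.ofReal_pow (Real.sqrt_nonneg _), Real.sq_sqrt ENNReal.toReal_nonneg,
          ENNReal.ofReal_toReal hT]

theorem opNorm_theta_self (x : X) :
    E.opNorm p i (E.theta p x x) = ENNReal.ofReal (p i (E.inner x x)) := by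
  have h1 : E.opNorm p i (E.theta p x x) ≤ ENNReal.ofReal (p i (E.inner x x)) := by
    rw [opNorm_le_ofReal _ _ _ ((p i).nonneg _)]
    intro z
    refine (E.seminorm_act_le (p i) x (E.inner x z)).trans ?_
    rw [← E.seminorm_sq]
    nlinarith [mul_le_mul_of_nonneg_right (E.inner_le (p i) x z) (E.seminorm_nonneg (p i) x)]
  refine le_antisymm h1 ?_
  have hT : E.opNorm p i (E.theta p x x) ≠ ⊤ := ne_top_of_le_ne_top ENNReal.ofReal_ne_top h1
  refine ENNReal.ofReal_le_of_le_toReal ?_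
  have h2 := E.seminorm_apply_le p i hT x
  have h3 := E.inner_le (p i) x ((E.theta p x x) x)
  -- The lower bound comes from testing `θ_{x,x}` on `x` itself.
  have h4 : p i (E.inner x ((E.theta p x x) x)) = p i (E.inner x x) ^ 2 := by
    rw [← (p i).star_mul_self, E.star_inner, ← E.inner_act_right]
    rfl
  rw [h4, ← E.seminorm_sq] at h3
  rw [← E.seminorm_sq]
  have h5 := mul_le_mul_of_nonneg_left h2 (E.seminorm_nonneg (p i) x)
  rcases (E.seminorm_nonneg (p i) x).eq_or_lt with h0 | h0
  · rw [← h0, zero_pow two_ne_zero]; exact ENNReal.toReal_nonneg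
  · have h6 : 0 < E.seminorm (p i) x ^ 2 := by positivity
    refine le_of_mul_le_mul_right ?_ h6
    nlinarith

theorem theta_apply (x y z : X) : (E.theta p x y) z = E.act x (E.inner y z) := rfl

theorem mul_theta (T : E.Adj p) (x y : X) : T * E.theta p x y = E.theta p (T x) y :=
  Subtype.ext <| LinearMap.ext fun z => T.2.1 x (E.inner y z)

theorem star_theta (x y : X) : star (E.theta p x y) = E.theta p y x :=
  E.star_eq_of_isAdjoint p ⟨(E.theta p y x).2.1, fun z w => by
    change E.inner (E.act x (E.inner y z)) w = E.inner z (E.act y (E.inner x w))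
    rw [E.inner_act_left, E.inner_act_right, E.star_inner]⟩

theorem mem_closure {S : Set (E.Adj p)} {T : E.Adj p} :
    T ∈ closure S ↔ ∀ (s : Finset Λ) (ε : ℝ≥0∞), 0 < ε →
      ∃ U ∈ S, ∀ i ∈ s, E.opNorm p i (U - T) < ε :=
  mem_closure_seminormTopology (E.opNorm_zero p) (E.opNorm_add_le p)

theorem eventually_nhds (T : E.Adj p) {ε : ℝ≥0∞} (hε : 0 < ε) :
    ∀ᶠ U in 𝓝 T, E.opNorm p i (U - T) < ε :=
  eventually_nhds_seminormTopology (E.opNorm_zero p) (E.opNorm_add_le p) T i hε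

theorem opNorm_sub_lt_add {T U V : E.Adj p} {ε δ : ℝ≥0∞} (h : E.opNorm p i (T - U) < ε)
    (h' : E.opNorm p i (U - V) < δ) : E.opNorm p i (T - V) < ε + δ := by
  have h1 := E.opNorm_add_le p i (T - U) (U - V)
  rw [sub_add_sub_cancel] at h1
  exact h1.trans_lt (ENNReal.add_lt_add h h')

theorem eq_of_opNorm_sub {Λ : Type w} [UniformSpace A] {p : Λ → CStarSeminorm A}
    (hA : IsProCStarAlgebra p) {T S : E.Adj p} (h : ∀ i, E.opNorm p i (T - S) = 0) :
    T = S := by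
  rw [← sub_eq_zero]
  refine Subtype.ext (LinearMap.ext fun x => ?_)
  refine (E.inner_self_eq_zero _).1 (hA.ext fun i => ?_)
  rw [sub_zero, ← E.seminorm_sq]
  have h1 := (E.opNorm_le_ofReal p i le_rfl).1 ((h i).le.trans ENNReal.ofReal_zero.ge) x
  rw [zero_mul] at h1
  exact pow_eq_zero_iff two_ne_zero |>.2 (le_antisymm h1 (E.seminorm_nonneg _ _))

end InnerModule

/-! ### Finite-rank operators, the quotients at each level, and the ideal `J` -/

namespace InnerModule

variable {A : Type u} [NonUnitalRing A] [StarRing A] [Module ℂ A]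
  {X : Type v} [AddCommGroup X] [Module ℂ X] (E : InnerModule A X)
  [IsScalarTower ℂ A A] [SMulCommClass ℂ A A] [StarModule ℂ A]
  {Λ : Type w} (p : Λ → CStarSeminorm A) (i : Λ)

/-- The linear span of the operators `θ_{y,x}`. -/
def finiteRank : Submodule ℂ (E.Adj p) := Submodule.span ℂ {T | ∃ y x : X, T = E.theta p y x}

theorem theta_mem_finiteRank (x y : X) : E.theta p x y ∈ E.finiteRank p :=
  Submodule.subset_span ⟨x, y, rfl⟩

theorem mem_compacts {T : E.Adj p} :
    T ∈ E.compacts p ↔ ∀ (s : Finset Λ) (ε : ℝ≥0∞), 0 < ε →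
      ∃ U ∈ E.finiteRank p, ∀ i ∈ s, E.opNorm p i (U - T) < ε :=
  E.mem_closure p

/-- The canonical map `L_A(X) → L_{A_i}(X_i)` as a linear map. -/
def adjProjₗ : E.Adj p →ₗ[ℂ] E.QuotAdj p i where
  toFun := E.adjProj p i
  map_add' T S := Subtype.ext <| LinearMap.ext <| by rintro ⟨x⟩; rfl
  map_smul' c T := Subtype.ext <| LinearMap.ext <| by rintro ⟨x⟩; rfl

/-- Every class in `X_i` has a representative with the same seminorm, so both suprema run over the
same values. -/
theorem opNorm_adjProj (T : E.Adj p) :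
    (E.quot (p i)).opNorm (fun _ : Unit => (p i).quotNorm) () (E.adjProj p i T)
      = E.opNorm p i T :=
  (E.ker (p i)).mkQ_surjective.iSup_comp
    (fun x => ⨆ (_ : (E.quot (p i)).seminorm ((p i).quotNorm) x ≤ 1),
      ENNReal.ofReal ((E.quot (p i)).seminorm ((p i).quotNorm) (E.adjProj p i T x))) |>.symm

theorem adjProj_eq_zero {T : E.Adj p} : E.adjProj p i T = 0 ↔ E.opNorm p i T = 0 := by
  constructor
  · intro h
    rw [← opNorm_adjProj, h, opNorm_zero]
  · intro h
    refine Subtype.ext (LinearMap.ext ?_)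
    rintro ⟨x⟩
    refine (Submodule.Quotient.mk_eq_zero _).2 ?_
    have h1 := (E.opNorm_le_ofReal p i le_rfl).1 (h.le.trans ENNReal.ofReal_zero.ge) x
    rw [zero_mul] at h1
    exact le_antisymm h1 (E.seminorm_nonneg _ _)

theorem map_finiteRank :
    (E.finiteRank p).map (E.adjProjₗ p i)
      = (E.quot (p i)).finiteRank (fun _ : Unit => (p i).quotNorm) := by
  rw [finiteRank, finiteRank, Submodule.map_span]
  congr 1
  ext T
  constructor
  · rintro ⟨_, ⟨y, x, rfl⟩, rfl⟩
    refine ⟨(E.ker (p i)).mkQ y, (E.ker (p i)).mkQ x, Subtype.ext (LinearMap.ext ?_)⟩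
    rintro ⟨z⟩
    rfl
  · rintro ⟨⟨y⟩, ⟨x⟩, rfl⟩
    refine ⟨_, ⟨y, x, rfl⟩, Subtype.ext (LinearMap.ext ?_)⟩
    rintro ⟨z⟩
    rfl

theorem adjProj_mem_quotCompacts {T : E.Adj p} :
    E.adjProj p i T ∈ E.quotCompacts p i ↔ ∀ ε : ℝ≥0∞, 0 < ε →
      ∃ U ∈ E.finiteRank p, E.opNorm p i (U - T) < ε := by
  have hsub : ∀ U : E.Adj p, (E.quot (p i)).opNorm (fun _ : Unit => (p i).quotNorm) ()
      (E.adjProjₗ p i U - E.adjProj p i T) = E.opNorm p i (U - T) := by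
    intro U
    rw [← E.opNorm_adjProj p i (U - T)]
    exact congrArg _ (map_sub (E.adjProjₗ p i) U T).symm
  rw [quotCompacts, mem_compacts, ← map_finiteRank]
  constructor
  · intro h ε hε
    obtain ⟨_, ⟨U, hU, rfl⟩, h'⟩ := h {()} ε hε
    exact ⟨U, hU, (hsub U).symm.trans_lt (h' () (Finset.mem_singleton_self _))⟩
  · intro h s ε hε
    obtain ⟨U, hU, h'⟩ := h ε hε
    exact ⟨_, ⟨U, hU, rfl⟩, fun j _ => (hsub U).trans_lt h'⟩

variable (φ : A →⋆ₙₐ[ℂ] E.Adj p)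

/-- This eliminates the quotients: finite-rank operators on `X_i` lift to `X`, so both conditions
can be tested on `X` with the `i`-th seminorm. The approximating operator may depend on `i`. -/
theorem mem_katsuraIdeal {E : InnerModule A X} {p : Λ → CStarSeminorm A}
    {φ : A →⋆ₙₐ[ℂ] E.Adj p} {a : A} :
    a ∈ katsuraIdeal E φ ↔ ∀ i,
      (∀ ε : ℝ≥0∞, 0 < ε → ∃ U ∈ E.finiteRank p, E.opNorm p i (U - φ a) < ε) ∧
        ∀ b, E.opNorm p i (φ b) = 0 → p i (a * b) = 0 := by
  simp only [katsuraIdeal, katsuraIdealAt, Set.mem_iInter, Set.mem_ofPred_eq,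
    adjProj_mem_quotCompacts, adjProj_eq_zero, CStarSeminorm.proj_eq_zero]

/-- The C*-seminorm `a ↦ p_{i, L_A(X)}(φ a)` of `A`. -/
def opSeminorm (hφ : ∀ a, E.opNorm p i (φ a) ≠ ⊤) : CStarSeminorm A where
  toFun a := (E.opNorm p i (φ a)).toReal
  map_zero' := by rw [map_zero, opNorm_zero, ENNReal.toReal_zero]
  add_le' a b := by
    rw [map_add, ← ENNReal.toReal_add (hφ a) (hφ b)]
    exact ENNReal.toReal_mono (ENNReal.add_ne_top.2 ⟨hφ a, hφ b⟩) (E.opNorm_add_le p i _ _)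
  neg' a := by
    rw [map_neg, ← zero_sub, opNorm_sub_rev, sub_zero]
  smul' c a := by
    rw [map_smul, opNorm_smul, ENNReal.toReal_mul, ENNReal.toReal_ofReal (norm_nonneg c)]
  mul_le' a b := by
    rw [map_mul, ← ENNReal.toReal_mul]
    exact ENNReal.toReal_mono (ENNReal.mul_ne_top (hφ a) (hφ b))
      (E.opNorm_mul_le p i _ _ (hφ a) (hφ b))
  star_mul_self' a := by
    rw [← ENNReal.toReal_pow]
    congr 1
    have hs : φ (star a * a) = star (φ a) * φ a := by rw [map_mul, map_star]
    rw [hs]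
    refine le_antisymm ?_ (E.opNorm_sq_le_star_mul_self p i _)
    refine (E.opNorm_mul_le p i _ _ ?_ (hφ a)).trans_eq ?_
    · rw [opNorm_star]; exact hφ a
    · rw [opNorm_star, sq]

theorem ofReal_opSeminorm (hφ : ∀ a, E.opNorm p i (φ a) ≠ ⊤) (a : A) :
    ENNReal.ofReal (E.opSeminorm p i φ hφ a) = E.opNorm p i (φ a) :=
  ENNReal.ofReal_toReal (hφ a)

theorem opSeminorm_eq_zero (hφ : ∀ a, E.opNorm p i (φ a) ≠ ⊤) {a : A} :
    E.opSeminorm p i φ hφ a = 0 ↔ E.opNorm p i (φ a) = 0 := by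
  rw [← E.ofReal_opSeminorm p i φ hφ, ENNReal.ofReal_eq_zero]
  exact ⟨fun h => h.le, fun h => le_antisymm h (CStarSeminorm.nonneg _ _)⟩

/-- A continuous morphism into `L_A(X)` takes bounded values. -/
theorem opNorm_ne_top_of_continuous [UniformSpace A] (hA : IsProCStarAlgebra p)
    (hφ : Continuous φ) (a : A) : E.opNorm p i (φ a) ≠ ⊤ := by
  -- By continuity some small multiple of `φ a` has seminorm below `1`, whereas an infinite value
  -- would survive multiplication by a nonzero scalar.
  have h1 : Tendsto (fun n : ℕ => ((1 / ((n : ℝ) + 1) : ℝ) : ℂ) • a) atTop (𝓝 0) := by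
    rw [hA.withSeminorms.tendsto_nhds]
    intro j ε hε
    have h2 : Tendsto (fun n : ℕ => 1 / ((n : ℝ) + 1) * p j a) atTop (𝓝 (0 * p j a)) :=
      tendsto_one_div_add_atTop_nhds_zero_nat.mul_const _
    rw [zero_mul] at h2
    filter_upwards [h2.eventually (gt_mem_nhds hε)] with n hn
    rw [sub_zero, map_smul_eq_mul, Complex.norm_real, Real.norm_of_nonneg (by positivity)]
    exact hn
  have h2 := (hφ.tendsto 0).comp h1
  obtain ⟨n, hn⟩ := (h2.eventually (E.eventually_nhds p i (φ 0) one_pos)).exists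
  rw [Function.comp_apply, map_zero, sub_zero, map_smul, opNorm_smul, Complex.norm_real,
    Real.norm_of_nonneg (by positivity)] at hn
  intro h
  rw [h, ENNReal.mul_top (by simp; positivity)] at hn
  exact absurd hn (by simp)

end InnerModule

/-! ### From a bimodule to an isometry of `J` onto `K_A(X)` -/

section

variable {A : Type u} [NonUnitalRing A] [StarRing A] [Module ℂ A]
  [IsScalarTower ℂ A A] [SMulCommClass ℂ A A] [StarModule ℂ A]
  {X : Type v} [AddCommGroup X] [Module ℂ X] {Λ : Type w} {p : Λ → CStarSeminorm A}

namespace LeftHilbertProModule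

variable (M : LeftHilbertProModule p X)

theorem inner_add_right (x y z : X) : M.inner x (y + z) = M.inner x y + M.inner x z := by
  rw [← M.star_inner, M.inner_add_left, star_add, M.star_inner, M.star_inner]

theorem inner_smul_right (c : ℂ) (x y : X) : M.inner x (c • y) = star c • M.inner x y := by
  rw [← M.star_inner, M.inner_smul_left, star_smul, M.star_inner]

theorem inner_act_right (x y : X) (a : A) : M.inner x (M.act a y) = M.inner x y * star a := by
  rw [← M.star_inner, M.inner_act_left, star_mul, M.star_inner]

theorem inner_sub_left (x y z : X) : M.inner (x - y) z = M.inner x z - M.inner y z := by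
  have := M.inner_add_left (x - y) y z
  rw [sub_add_cancel] at this
  rw [this, add_sub_cancel_right]

theorem inner_sub_right (x y z : X) : M.inner x (y - z) = M.inner x y - M.inner x z := by
  have := M.inner_add_right x (y - z) z
  rw [sub_add_cancel] at this
  rw [this, add_sub_cancel_right]

theorem cauchySchwarz (i : Λ) (x y : X) :
    p i (M.inner x y) ^ 2 ≤ p i (M.inner x x) * p i (M.inner y y) := by
  obtain ⟨D, _, f, hf⟩ := (p i).exists_cstarAlgebra
  rw [← hf, ← hf, ← hf]
  refine norm_sq_le_of_quadratic_nonneg _ _ _ ?_ ?_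
  · intro s
    obtain ⟨w, hw⟩ := M.inner_self_nonneg (y - ((s : ℝ) : ℂ) • M.act (M.inner y x) x)
    refine ⟨f w, ?_⟩
    rw [show star (f w) * f w = f (star w * w) by rw [map_mul, map_star], ← hw]
    simp only [M.inner_sub_left, M.inner_sub_right, M.inner_smul_left, M.inner_smul_right,
      M.inner_act_left, M.inner_act_right, M.star_inner, map_sub, map_smul, map_mul]
    rw [← map_star, M.star_inner]
    simp only [RCLike.star_def, Complex.conj_ofReal, Complex.coe_smul, mul_assoc]
    module
  · obtain ⟨u, hu⟩ := M.inner_self_nonneg x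
    exact ⟨f u, by rw [hu, map_mul, map_star]⟩

theorem seminorm_sq (i : Λ) (x : X) : M.seminorm i x ^ 2 = p i (M.inner x x) :=
  Real.sq_sqrt ((p i).nonneg _)

theorem inner_le (i : Λ) (x y : X) :
    p i (M.inner x y) ≤ M.seminorm i x * M.seminorm i y := by
  refine (pow_le_pow_iff_left₀ (b := M.seminorm i x * M.seminorm i y) ((p i).nonneg _)
    (mul_nonneg (Real.sqrt_nonneg _) (Real.sqrt_nonneg _)) two_ne_zero).1 ?_
  rw [mul_pow, M.seminorm_sq, M.seminorm_sq]
  exact M.cauchySchwarz i x y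

end LeftHilbertProModule

/-- The elements of `A` that annihilate the kernel of `a ↦ p_{i, L_A(X)}(φ a)` modulo the kernel
of `p i`. -/
def kernelAnnihilator {E : InnerModule A X} (φ : A →⋆ₙₐ[ℂ] E.Adj p) (i : Λ) : Submodule ℂ A where
  carrier := {a | ∀ b, E.opNorm p i (φ b) = 0 → p i (a * b) = 0}
  zero_mem' b _ := by rw [zero_mul, CStarSeminorm.apply_zero]
  add_mem' {a a'} ha ha' b hb := by
    rw [add_mul]
    exact (p i).ker.add_mem (ha b hb) (ha' b hb)
  smul_mem' c a ha b hb := by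
    rw [smul_mul_assoc]
    exact (p i).ker.smul_mem c (ha b hb)

namespace HilbertProBimodule

variable (M : HilbertProBimodule p p X)

/-- In a bimodule, the left seminorms are dominated by the right ones. -/
theorem left_seminorm_le (i : Λ) (x : X) :
    M.left.seminorm i x ≤ M.right.toInnerModule.seminorm (p i) x := by
  -- Write `ℓ` and `r` for the left and right seminorms of `x`. This identity, Cauchy–Schwarz on the
  -- left and the bound for the right action give `ℓ⁴ ≤ r² ℓ²`.
  have h1 : p i (M.left.inner x x) ^ 2
      = p i (M.left.inner (M.right.act x (M.right.inner x x)) x) := by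
    rw [← M.inner_act, M.left.inner_act_left, ← (p i).star_mul_self, M.left.star_inner]
  have h2 := M.left.inner_le i (M.right.act x (M.right.inner x x)) x
  have h3 := M.seminorm_right_act i (M.right.inner x x) x
  have h0 : 0 ≤ M.left.seminorm i x := Real.sqrt_nonneg _
  have hr := M.right.toInnerModule.seminorm_nonneg (p i) x
  rw [← h1, ← M.left.seminorm_sq] at h2
  rw [← M.right.toInnerModule.seminorm_sq] at h3
  rcases h0.eq_or_lt with h | h
  · rw [← h]; exact hr
  · have h4 := mul_le_mul_of_nonneg_right h3 h0
    have h5 : 0 < M.left.seminorm i x ^ 2 := by positivity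
    refine (pow_le_pow_iff_left₀ h0 hr two_ne_zero).1 (le_of_mul_le_mul_right ?_ h5)
    nlinarith

variable {M} {φ : A →⋆ₙₐ[ℂ] M.right.toInnerModule.Adj p} (hM : ∀ a x, M.left.act a x = (φ a) x)

include hM

theorem opNorm_le (i : Λ) (a : A) :
    M.right.toInnerModule.opNorm p i (φ a) ≤ ENNReal.ofReal (p i a) := by
  rw [InnerModule.opNorm_le_ofReal _ _ _ ((p i).nonneg a)]
  intro x
  rw [← hM]
  exact M.seminorm_left_act i a x

theorem opNorm_ne_top (i : Λ) (a : A) : M.right.toInnerModule.opNorm p i (φ a) ≠ ⊤ :=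
  ne_top_of_le_ne_top ENNReal.ofReal_ne_top (opNorm_le hM i a)

theorem map_inner (x y : X) : φ (M.left.inner x y) = M.right.toInnerModule.theta p x y :=
  Subtype.ext <| LinearMap.ext fun z => (hM _ z).symm.trans (M.inner_act x y z)

theorem map_span_inner :
    (Submodule.span ℂ {a | ∃ x y, a = M.left.inner x y}).map (φ : A →ₗ[ℂ] _)
      = M.right.toInnerModule.finiteRank p := by
  rw [Submodule.map_span, InnerModule.finiteRank]
  congr 1
  ext T
  constructor
  · rintro ⟨_, ⟨x, y, rfl⟩, rfl⟩
    exact ⟨x, y, map_inner hM x y⟩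
  · rintro ⟨x, y, rfl⟩
    exact ⟨_, ⟨x, y, rfl⟩, map_inner hM x y⟩

/-- In `⟨x, y⟩ b = ⟨x, b* y⟩`, the vector `b* y` has right seminorm zero when `φ b` vanishes at
level `i`. Its left seminorm is then zero as well, and Cauchy–Schwarz concludes. -/
theorem span_inner_le (i : Λ) :
    Submodule.span ℂ {a | ∃ x y, a = M.left.inner x y} ≤ kernelAnnihilator φ i := by
  rw [Submodule.span_le]
  rintro _ ⟨x, y, rfl⟩ b hb
  have h1 : M.left.inner x y * b = M.left.inner x (M.left.act (star b) y) := by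
    rw [M.left.inner_act_right, star_star]
  have h2 : M.right.toInnerModule.opNorm p i (φ (star b)) ≤ ENNReal.ofReal 0 := by
    rw [map_star, InnerModule.opNorm_star, hb, ENNReal.ofReal_zero]
  have h3 := (InnerModule.opNorm_le_ofReal _ p i le_rfl).1 h2 y
  rw [zero_mul, ← hM] at h3
  have h4 : M.left.seminorm i (M.left.act (star b) y) = 0 :=
    le_antisymm ((M.left_seminorm_le i _).trans h3) (Real.sqrt_nonneg _)
  have h5 := M.left.inner_le i x (M.left.act (star b) y)
  rw [h4, mul_zero] at h5
  rw [h1]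
  exact le_antisymm h5 ((p i).nonneg _)

variable [UniformSpace A] (hA : IsProCStarAlgebra p)

include hA

/-- The abstract norm comparison applied to the C*-seminorm `b ↦ ‖φ b‖_i`, which is dominated by `p
i` because of the bimodule inequality for the left action. -/
theorem opNorm_eq {i : Λ} {a : A} (ha : a ∈ kernelAnnihilator φ i) :
    M.right.toInnerModule.opNorm p i (φ a) = ENNReal.ofReal (p i a) := by
  have hf := opNorm_ne_top hM i
  rw [hA.eq_of_mul_ker_eq_zero (q := M.right.toInnerModule.opSeminorm p i φ hf) (i := i) (a := a),
    InnerModule.ofReal_opSeminorm]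
  · intro b
    have h := opNorm_le hM i b
    rwa [← InnerModule.ofReal_opSeminorm _ _ _ _ hf,
      ENNReal.ofReal_le_ofReal_iff ((p i).nonneg b)] at h
  · intro b hb
    exact ha b ((InnerModule.opSeminorm_eq_zero _ p i φ hf).1 hb)

/-- Membership in `J` gives approximation at one level at a time, while `K_A(X)` needs finitely many
levels simultaneously. The passage is made in `A`: approximate at a dominating level `j`, lift to `p
j (u - a)` by isometry, and descend to the smaller `p i`. -/
theorem mapsTo_compacts :
    Set.MapsTo φ (katsuraIdeal M.right.toInnerModule φ) (M.right.toInnerModule.compacts p) := by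
  intro a ha
  rw [InnerModule.mem_katsuraIdeal] at ha
  rw [InnerModule.mem_compacts]
  intro s ε hε
  rcases s.eq_empty_or_nonempty with rfl | hs
  · exact ⟨0, Submodule.zero_mem _, by simp⟩
  obtain ⟨j, hj⟩ := hA.exists_forall_le hs
  obtain ⟨U, hU, hUa⟩ := (ha j).1 ε hε
  rw [← map_span_inner hM] at hU
  obtain ⟨u, hu, rfl⟩ := hU
  refine ⟨φ u, ?_, fun i hi => ?_⟩
  · rw [← map_span_inner hM]
    exact ⟨u, hu, rfl⟩
  have h1 : u - a ∈ kernelAnnihilator φ j := sub_mem (span_inner_le hM j hu) (ha j).2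
  have h2 := opNorm_eq hM hA h1
  rw [← map_sub]
  refine (opNorm_le hM i _).trans_lt ?_
  refine (ENNReal.ofReal_le_ofReal (hj i hi _)).trans_lt ?_
  rw [← h2, map_sub]
  exact hUa

/-- Finite-rank approximants of `T` lift to the span of the left inner products, where `φ` is
isometric. The lifts are therefore Cauchy, and their limit is the required preimage. -/
theorem surjOn_compacts :
    Set.SurjOn φ (katsuraIdeal M.right.toInnerModule φ) (M.right.toInnerModule.compacts p) := by
  intro T hT
  have hT' := (M.right.toInnerModule.mem_compacts p).1 hT
  let S : Submodule ℂ A := Submodule.span ℂ {a | ∃ x y, a = M.left.inner x y}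
  have hT2 : T ∈ closure (φ '' S) := by
    refine (M.right.toInnerModule.mem_closure p).2 fun s ε hε => ?_
    obtain ⟨U, hU, h⟩ := hT' s ε hε
    rw [← map_span_inner hM] at hU
    exact ⟨U, hU, h⟩
  -- A filter on `A` that lives on the span and is sent by `φ` to a filter converging to `T`.
  obtain ⟨G, hG, hGT⟩ : ∃ G : Filter A, (G.NeBot ∧ (S : Set A) ∈ G) ∧ Tendsto φ G (𝓝 T) := by
    have h1 : (𝓝 T ⊓ 𝓟 (φ '' S)).NeBot := mem_closure_iff_nhdsWithin_neBot.1 hT2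
    exact ⟨comap φ (𝓝 T ⊓ 𝓟 (φ '' S)) ⊓ 𝓟 S,
      ⟨comap_inf_principal_neBot_of_image_mem h1 (mem_inf_of_right (mem_principal_self _)),
        mem_inf_of_right (mem_principal_self _)⟩,
      (tendsto_comap.mono_left inf_le_left).mono_right inf_le_left⟩
  obtain ⟨hGne, hSG⟩ := hG
  have hev : ∀ (i : Λ) (ε : ℝ≥0∞), 0 < ε → ∀ᶠ u in G, u ∈ S ∧ M.right.toInnerModule.opNorm p i (φ u - T) < ε :=
    fun i ε hε => (show ∀ᶠ u in G, u ∈ S from hSG).and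
      (hGT.eventually (M.right.toInnerModule.eventually_nhds p i T hε))
  obtain ⟨a, ha⟩ := hA.isSeminormComplete G hGne (by
    intro i ε hε
    refine ⟨_, hev i (ENNReal.ofReal (ε / 2)) (by simpa using hε), ?_⟩
    rintro x ⟨hxS, hx⟩ y ⟨hyS, hy⟩
    rw [M.right.toInnerModule.opNorm_sub_rev] at hy
    have h1 := M.right.toInnerModule.opNorm_sub_lt_add p i hx hy
    rw [← map_sub, opNorm_eq hM hA (span_inner_le hM i (sub_mem hxS hyS)),
      ← ENNReal.ofReal_add (by positivity) (by positivity), add_halves,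
      ENNReal.ofReal_lt_ofReal_iff hε] at h1
    exact h1)
  have hφa : φ a = T := by
    refine M.right.toInnerModule.eq_of_opNorm_sub hA fun i => ?_
    refine nonpos_iff_eq_zero.1 (ENNReal.le_of_forall_pos_le_add fun ε hε _ => ?_)
    have hε' : (0 : ℝ) < ε / 2 := by positivity
    obtain ⟨u, ⟨-, hu⟩, hua⟩ := ((hev i (ENNReal.ofReal (ε / 2)) (by simpa using hε)).and
      ((ha i).eventually (gt_mem_nhds hε'))).exists
    have h1 : M.right.toInnerModule.opNorm p i (φ a - φ u) < ENNReal.ofReal (ε / 2) := by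
      rw [M.right.toInnerModule.opNorm_sub_rev, ← map_sub]
      exact (opNorm_le hM i _).trans_lt ((ENNReal.ofReal_lt_ofReal_iff hε').2 hua)
    refine (M.right.toInnerModule.opNorm_sub_lt_add p i h1 hu).le.trans_eq ?_
    rw [← ENNReal.ofReal_add hε'.le hε'.le, add_halves, ENNReal.ofReal_coe_nnreal, zero_add]
  refine ⟨a, InnerModule.mem_katsuraIdeal.2 fun i => ⟨fun ε hε => ?_, fun b hb => ?_⟩, hφa⟩
  · obtain ⟨U, hU, h⟩ := hT' {i} ε hε
    exact ⟨U, hU, by rw [hφa]; exact h i (Finset.mem_singleton_self i)⟩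
  -- Annihilation passes to the limit: `u b` vanishes at level `i` for `u` in the span, so `p i (a
  -- b)` is at most `p i (u - a) * p i b`.
  · have h1 : Tendsto (fun u => p i (u - a) * p i b) G (𝓝 (0 * p i b)) := (ha i).mul_const _
    rw [zero_mul] at h1
    refine le_antisymm (ge_of_tendsto h1 ?_) ((p i).nonneg _)
    filter_upwards [hSG] with u hu
    have h2 : a * b = u * b - (u - a) * b := by noncomm_ring
    have h3 := span_inner_le hM i hu b hb
    have h4 := (p i).abs_sub_le (a * b) (u * b)
    have h5 := (p i).mul_le (a - u) b
    rw [← sub_mul, h3, sub_zero, abs_of_nonneg ((p i).nonneg _)] at h4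
    have h6 : p i (a - u) = p i (u - a) := map_sub_rev (p i).toSeminorm a u
    rw [← h6]
    exact h4.trans h5

end HilbertProBimodule

namespace InnerModule

variable {E : InnerModule A X} {φ : A →⋆ₙₐ[ℂ] E.Adj p}

/-- Isometry is required for differences since `S` is an arbitrary set. It gives injectivity, `A`
being Hausdorff, and continuity of the inverse. -/
theorem isHomeomorph_restrict [UniformSpace A] (hA : IsProCStarAlgebra p) (hφ : Continuous φ)
    {S : Set A} {K : Set (E.Adj p)} (h : Set.MapsTo φ S K) (hS : Set.SurjOn φ S K)
    (hiso : ∀ i, ∀ a ∈ S, ∀ b ∈ S, E.opNorm p i (φ a - φ b) = ENNReal.ofReal (p i (a - b))) :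
    IsHomeomorph h.restrict := by
  have hinj : Function.Injective h.restrict := by
    rintro ⟨a, ha⟩ ⟨b, hb⟩ hab
    have h1 : φ a = φ b := congrArg Subtype.val hab
    refine Subtype.ext (hA.ext fun i => ?_)
    have h2 := hiso i a ha b hb
    rw [h1, sub_self, E.opNorm_zero, eq_comm, ENNReal.ofReal_eq_zero] at h2
    exact le_antisymm h2 ((p i).nonneg _)
  have hsurj : Function.Surjective h.restrict := by
    rintro ⟨T, hT⟩
    obtain ⟨a, ha, rfl⟩ := hS hT
    exact ⟨⟨a, ha⟩, rfl⟩
  have hcont : Continuous h.restrict := hφ.restrict h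
  let e := Equiv.ofBijective h.restrict ⟨hinj, hsurj⟩
  have hinv : Continuous e.symm := by
    rw [continuous_iff_continuousAt]
    intro T
    rw [ContinuousAt, tendsto_subtype_rng, hA.withSeminorms.tendsto_nhds]
    intro i ε hε
    have hev := (continuous_subtype_val.tendsto T).eventually
      (E.eventually_nhds p i T.1 (ε := ENNReal.ofReal ε) (by simpa using hε))
    filter_upwards [hev] with S hS
    have h1 : ∀ T, φ (e.symm T).1 = T.1 := fun T => congrArg Subtype.val (e.apply_symm_apply T)
    rw [← h1 S, ← h1 T, hiso i _ (e.symm S).2 _ (e.symm T).2,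
      ENNReal.ofReal_lt_ofReal_iff hε] at hS
    exact hS
  exact (Homeomorph.mk e hcont hinv).isHomeomorph

end InnerModule

/-! ### Negative parts, ideal properties of `J`, and positivity -/

theorem CStarSeminorm.eq_zero_of_star_mul_self_add (r : CStarSeminorm A) {a b : A}
    (h : star a * a + star b * b = 0) : r a = 0 := by
  obtain ⟨D, _, f, hf⟩ := r.exists_cstarAlgebra
  let _ : PartialOrder D := CStarAlgebra.spectralOrder D
  have _ : StarOrderedRing D := CStarAlgebra.spectralOrderedRing D
  have h1 : star (f a) * f a + star (f b) * f b = 0 := by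
    rw [← map_star, ← map_star, ← map_mul, ← map_mul, ← map_add, h, map_zero]
  have h2 := ((add_eq_zero_iff_of_nonneg (star_mul_self_nonneg _)
    (star_mul_self_nonneg _)).1 h1).1
  rw [← hf, norm_eq_zero]
  exact CStarRing.star_mul_self_eq_zero_iff _ |>.1 h2

/-- The decomposition of a self-adjoint element of a pro-C*-algebra: `n` is its negative part,
`star b * b` its positive part, and `star c * c` the cube of `n`. -/
theorem IsProCStarAlgebra.exists_negPart [UniformSpace A] (hA : IsProCStarAlgebra p) {h : A}
    (hh : star h = h) :
    ∃ n b c : A, star n = n ∧ star b * b = h + n ∧ star c * c = -(n * (h * n)) ∧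
      (n * (h * n) = 0 → n = 0) := by
  obtain ⟨n, hn⟩ := hA.exists_cfc hh (g := fun t => max (-t) 0) (by fun_prop) (by simp)
  obtain ⟨b, hb⟩ := hA.exists_cfc hh (g := fun t => √(max t 0)) (by fun_prop) (by simp)
  -- `c = n^{3/2}`, and `n h n = -n³` because `h n = -n²`.
  obtain ⟨c, hc⟩ := hA.exists_cfc hh (g := fun t => max (-t) 0 * √(max (-t) 0)) (by fun_prop)
    (by simp)
  -- Equalities in `A` may be checked in C*-algebras realising the seminorms; there they become
  -- identities between functions on the spectrum of `f h`.
  have key : ∀ a a' : A, (∀ (D : Type u) [CStarAlgebra D] (f : A →⋆ₙₐ[ℂ] D) (i : Λ),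
      (∀ a, ‖f a‖ = p i a) → IsSelfAdjoint (f h) → f a = f a') → a = a' := by
    intro a a' H
    refine hA.ext fun i => ?_
    obtain ⟨D, _, f, hf⟩ := (p i).exists_cstarAlgebra
    have hs : IsSelfAdjoint (f h) := by rw [IsSelfAdjoint, ← map_star, hh]
    rw [← hf, map_sub, H D f i hf hs, sub_self, norm_zero]
  have hstar : ∀ (D : Type u) [CStarAlgebra D] (a : D) (g : ℝ → ℝ), star (cfc g a) = cfc g a :=
    fun D _ a g => (cfc_predicate g a : IsSelfAdjoint _).star_eq
  have hnhn : ∀ (D : Type u) [CStarAlgebra D] (f : A →⋆ₙₐ[ℂ] D) (i : Λ),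
      (∀ a, ‖f a‖ = p i a) → IsSelfAdjoint (f h) →
      f (n * (h * n)) = cfc (fun t : ℝ => max (-t) 0 * (t * max (-t) 0)) (f h) := by
    intro D _ f i hf hs
    rw [map_mul, map_mul, hn D f i fun a => (hf a).le]
    nth_rewrite 2 [← cfc_id' ℝ (f h)]
    rw [← cfc_mul _ _ _ (by fun_prop) (by fun_prop), ← cfc_mul _ _ _ (by fun_prop) (by fun_prop)]
  refine ⟨n, b, c, ?_, ?_, ?_, fun h0 => ?_⟩
  · refine key _ _ fun D _ f i hf hs => ?_
    rw [map_star, hn D f i fun a => (hf a).le, hstar]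
  · refine key _ _ fun D _ f i hf hs => ?_
    rw [map_mul, map_star, map_add, hn D f i fun a => (hf a).le, hb D f i fun a => (hf a).le,
      hstar, ← cfc_mul _ _ _ (by fun_prop) (by fun_prop)]
    nth_rewrite 2 [← cfc_id' ℝ (f h)]
    rw [← cfc_add _ _ _ (by fun_prop) (by fun_prop)]
    refine cfc_congr fun t _ => ?_
    change √(max t 0) * √(max t 0) = t + max (-t) 0
    rw [Real.mul_self_sqrt (le_max_right _ _)]
    rcases le_total t 0 with ht | ht
    · rw [max_eq_right ht, max_eq_left (neg_nonneg.2 ht), add_neg_cancel]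
    · rw [max_eq_left ht, max_eq_right (neg_nonpos.2 ht), add_zero]
  · refine key _ _ fun D _ f i hf hs => ?_
    rw [map_neg, hnhn D f i hf hs, map_mul, map_star, hc D f i fun a => (hf a).le,
      hstar, ← cfc_mul _ _ _ (by fun_prop) (by fun_prop), ← cfc_neg]
    refine cfc_congr fun t _ => ?_
    change max (-t) 0 * √(max (-t) 0) * (max (-t) 0 * √(max (-t) 0))
      = -(max (-t) 0 * (t * max (-t) 0))
    have h1 := Real.mul_self_sqrt (le_max_right (-t) 0)
    rcases le_total t 0 with ht | ht
    · rw [max_eq_left (neg_nonneg.2 ht)] at h1 ⊢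
      linear_combination t ^ 2 * h1
    · rw [max_eq_right (neg_nonpos.2 ht)]; ring
  · refine key _ _ fun D _ f i hf hs => ?_
    have h1 := hnhn D f i hf hs
    rw [h0, map_zero] at h1
    rw [map_zero, hn D f i fun a => (hf a).le, ← cfc_zero ℝ (f h)]
    refine cfc_congr fun t ht => ?_
    have h2 := norm_apply_le_norm_cfc (fun t : ℝ => max (-t) 0 * (t * max (-t) 0)) (f h) ht
      (by fun_prop) hs
    rw [← h1, norm_zero, norm_le_zero_iff] at h2
    change max (-t) 0 = 0
    rcases mul_eq_zero.1 h2 with h3 | h3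
    · exact h3
    · rcases mul_eq_zero.1 h3 with h4 | h4
      · rw [h4, neg_zero, max_self]
      · exact h4

namespace InnerModule

variable {E : InnerModule A X} {φ : A →⋆ₙₐ[ℂ] E.Adj p}

theorem add_mem_katsuraIdeal {a b : A} (ha : a ∈ katsuraIdeal E φ) (hb : b ∈ katsuraIdeal E φ) :
    a + b ∈ katsuraIdeal E φ := by
  rw [mem_katsuraIdeal] at *
  refine fun i => ⟨fun ε hε => ?_, (kernelAnnihilator φ i).add_mem (ha i).2 (hb i).2⟩
  obtain ⟨U, hU, hUa⟩ := (ha i).1 (ε / 2) (ENNReal.half_pos hε.ne')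
  obtain ⟨V, hV, hVb⟩ := (hb i).1 (ε / 2) (ENNReal.half_pos hε.ne')
  refine ⟨U + V, add_mem hU hV, ?_⟩
  rw [map_add, add_sub_add_comm]
  refine (E.opNorm_add_le p i _ _).trans_lt ?_
  rw [← ENNReal.add_halves ε]
  exact ENNReal.add_lt_add hUa hVb

theorem mul_mem_finiteRank (T : E.Adj p) {U : E.Adj p} (hU : U ∈ E.finiteRank p) :
    T * U ∈ E.finiteRank p := by
  induction hU using Submodule.span_induction with
  | mem U hU =>
    obtain ⟨x, y, rfl⟩ := hU
    rw [E.mul_theta]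
    exact E.theta_mem_finiteRank p _ _
  | zero => rw [mul_zero]; exact zero_mem _
  | add U V _ _ hU hV => rw [mul_add]; exact add_mem hU hV
  | smul c U _ hU => rw [mul_smul_comm]; exact Submodule.smul_mem _ c hU

theorem star_mem_finiteRank {U : E.Adj p} (hU : U ∈ E.finiteRank p) :
    star U ∈ E.finiteRank p := by
  induction hU using Submodule.span_induction with
  | mem U hU =>
    obtain ⟨x, y, rfl⟩ := hU
    rw [E.star_theta]
    exact E.theta_mem_finiteRank p _ _
  | zero => rw [star_zero]; exact zero_mem _
  | add U V _ _ hU hV => rw [star_add]; exact add_mem hU hV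
  | smul c U _ hU => rw [star_smul]; exact Submodule.smul_mem _ _ hU

variable (hf : ∀ i a, E.opNorm p i (φ a) ≠ ⊤)

include hf

theorem star_mem_katsuraIdeal {a : A} (ha : a ∈ katsuraIdeal E φ) :
    star a ∈ katsuraIdeal E φ := by
  rw [mem_katsuraIdeal] at *
  refine fun i => ⟨fun ε hε => ?_, fun b hb => ?_⟩
  · obtain ⟨U, hU, hUa⟩ := (ha i).1 ε hε
    refine ⟨star U, star_mem_finiteRank hU, ?_⟩
    rwa [map_star, ← star_sub, opNorm_star]
  -- With `b` also `a* b` is in the kernel at level `i`, so `a` annihilates it, and `p (a* b)² = p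
  -- (b* a a* b) = 0`.
  · have h1 : E.opNorm p i (φ (star a * b)) = 0 := by
      rw [map_mul, ← nonpos_iff_eq_zero]
      refine (E.opNorm_mul_le p i _ _ (hf i _) (hf i _)).trans_eq ?_
      rw [hb, mul_zero]
    have h2 := (p i).mul_mem_ker_right (star b) ((ha i).2 _ h1)
    rw [CStarSeminorm.mem_ker] at h2
    have h3 := (p i).star_mul_self (star a * b)
    rw [star_mul, star_star, mul_assoc, h2] at h3
    exact pow_eq_zero_iff two_ne_zero |>.1 h3.symm

theorem mul_mem_katsuraIdeal (b : A) {a : A} (ha : a ∈ katsuraIdeal E φ) :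
    b * a ∈ katsuraIdeal E φ := by
  rw [mem_katsuraIdeal] at *
  refine fun i => ⟨fun ε hε => ?_, fun c hc => ?_⟩
  -- If `φ b` has seminorm zero the quotient is `⊤`, and the estimate still holds.
  · obtain ⟨U, hU, hUa⟩ := (ha i).1 (ε / E.opNorm p i (φ b)) (ENNReal.div_pos hε.ne' (hf i b))
    refine ⟨φ b * U, mul_mem_finiteRank _ hU, ?_⟩
    rw [map_mul, ← mul_sub]
    exact (E.opNorm_mul_le p i _ _ (hf i b) hUa.ne_top).trans_lt (ENNReal.mul_lt_of_lt_div' hUa)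
  · rw [mul_assoc]
    exact (p i).mul_mem_ker_right b ((ha i).2 c hc)

omit hf in
theorem smul_mem_katsuraIdeal (c : ℂ) {a : A} (ha : a ∈ katsuraIdeal E φ) :
    c • a ∈ katsuraIdeal E φ := by
  rw [mem_katsuraIdeal] at *
  refine fun i => ⟨fun ε hε => ?_, (kernelAnnihilator φ i).smul_mem c (ha i).2⟩
  obtain ⟨U, hU, hUa⟩ := (ha i).1 (ε / ENNReal.ofReal ‖c‖)
    (ENNReal.div_pos hε.ne' ENNReal.ofReal_ne_top)
  refine ⟨c • U, Submodule.smul_mem _ c hU, ?_⟩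
  rw [map_smul, ← smul_sub, opNorm_smul]
  exact ENNReal.mul_lt_of_lt_div' hUa

omit hf in
theorem zero_mem_katsuraIdeal : (0 : A) ∈ katsuraIdeal E φ := by
  rw [mem_katsuraIdeal]
  refine fun i => ⟨fun ε hε => ⟨0, zero_mem _, ?_⟩, (kernelAnnihilator φ i).zero_mem⟩
  rwa [map_zero, sub_zero, opNorm_zero]

/-- A self-adjoint element of `𝒥_X` that acts as `θ_{x,x}` is positive. -/
theorem exists_eq_star_mul_self [UniformSpace A] (hA : IsProCStarAlgebra p)
    (hinj : Set.InjOn φ (katsuraIdeal E φ)) {h : A} (hJ : h ∈ katsuraIdeal E φ)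
    (hh : star h = h) {x : X} (hx : φ h = E.theta p x x) : ∃ b, h = star b * b := by
  obtain ⟨n, b, c, hn, hb, hc, h0⟩ := hA.exists_negPart hh
  have hhn : h * n = star (n * h) := by rw [star_mul, hn, hh]
  have hmem : n * (h * n) ∈ katsuraIdeal E φ := by
    rw [hhn]
    exact mul_mem_katsuraIdeal hf n (star_mem_katsuraIdeal hf (mul_mem_katsuraIdeal hf n hJ))
  have hφ : φ (n * (h * n)) = E.theta p (φ n x) (φ n x) := by
    rw [hhn, map_mul, map_star, map_mul, hx, E.mul_theta, E.star_theta, E.mul_theta]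
  -- Here `φ(c)* φ(c) = -φ(n h n) = -θ_{nx,nx}`, with `nx = φ(n) x`. Pairing with `z` makes a sum of
  -- two positive elements of `A` equal to zero, so `φ(c) z = 0`.
  have hφc : φ c = 0 := by
    refine Subtype.ext (LinearMap.ext fun z => ?_)
    refine (E.inner_self_eq_zero _).1 ?_
    have h1 : E.inner ((φ c) z) ((φ c) z)
        + star (E.inner (φ n x) z) * E.inner (φ n x) z = 0 := by
      have h2 : φ (star c * c) = star (φ c) * φ c := by rw [map_mul, map_star]
      have h3 : (star (φ c)) ((φ c) z) = -((E.theta p (φ n x) (φ n x)) z) := by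
        rw [hc, map_neg, hφ] at h2
        exact (congrArg (fun T : E.Adj p => T z) h2).symm
      rw [(E.isAdjoint_star p (φ c)).2, h3, ← zero_sub, E.inner_sub_right, E.inner_zero_right,
        E.theta_apply, E.inner_act_right, E.star_inner, zero_sub, neg_add_cancel]
    obtain ⟨d, hd⟩ := E.inner_self_nonneg ((φ c) z)
    refine hA.ext fun i => ?_
    rw [hd] at h1 ⊢
    rw [sub_zero, (p i).star_mul_self, (p i).eq_zero_of_star_mul_self_add h1,
      zero_pow two_ne_zero]
  -- Injectivity is applied to `n h n`, which lies in `J`; nothing is claimed about `n` or `c` lying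
  -- there.
  have h4 : n * (h * n) = 0 := by
    refine hinj hmem zero_mem_katsuraIdeal ?_
    rw [map_zero, ← neg_neg (n * (h * n)), ← hc, map_neg, map_mul, hφc, mul_zero, neg_zero]
  exact ⟨b, by rw [hb, h0 h4, add_zero]⟩

end InnerModule

/-! ### From the isometry to the bimodule -/

/-- If `φ` maps `𝒥_X` isometrically onto `K_A(X)`, then `X` is a bimodule. -/
theorem HilbertProModule.exists_bimodule [UniformSpace A] (hA : IsProCStarAlgebra p)
    (E : HilbertProModule p X) (φ : A →⋆ₙₐ[ℂ] E.toInnerModule.Adj p)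
    (hf : ∀ i a, E.toInnerModule.opNorm p i (φ a) ≠ ⊤)
    (hbij : Set.BijOn φ (katsuraIdeal E.toInnerModule φ) (E.toInnerModule.compacts p))
    (hnorm : ∀ a ∈ katsuraIdeal E.toInnerModule φ, ∀ i,
      E.toInnerModule.opNorm p i (φ a) = ENNReal.ofReal (p i a)) :
    ∃ M : HilbertProBimodule p p X, M.right = E ∧ ∀ a x, M.left.act a x = (φ a) x := by
  have hex : ∀ x y : X, ∃ a ∈ katsuraIdeal E.toInnerModule φ,
      φ a = E.toInnerModule.theta p x y := fun x y =>
    hbij.surjOn (subset_closure (E.toInnerModule.theta_mem_finiteRank p x y))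
  choose L hLJ hL using hex
  have huniq : ∀ {x y : X} {a : A}, a ∈ katsuraIdeal E.toInnerModule φ →
      φ a = E.toInnerModule.theta p x y → L x y = a := fun ha h =>
    hbij.injOn (hLJ _ _) ha ((hL _ _).trans h.symm)
  have hstar : ∀ x y, star (L x y) = L y x := fun x y =>
    (huniq (InnerModule.star_mem_katsuraIdeal hf (hLJ x y))
      (by rw [map_star, hL, InnerModule.star_theta])).symm
  have hact : ∀ a x y, L ((φ a) x) y = a * L x y := fun a x y =>
    huniq (InnerModule.mul_mem_katsuraIdeal hf a (hLJ x y))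
      (by rw [map_mul, hL, InnerModule.mul_theta])
  -- Both sides equal the `i`-th seminorm of `θ_{x,x}`, so the left and right seminorms coincide.
  have hLn : ∀ i x, p i (L x x) = p i (E.inner x x) := by
    intro i x
    have h1 := hnorm _ (hLJ x x) i
    rw [hL, InnerModule.opNorm_theta_self] at h1
    exact ((ENNReal.ofReal_eq_ofReal_iff ((p i).nonneg _) ((p i).nonneg _)).1 h1).symm
  let M : LeftHilbertProModule p X :=
    { act := fun a x => (φ a) x
      act_add := fun a x y => map_add (φ a).1 x y
      add_act := fun a b x => by rw [map_add]; rfl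
      mul_act := fun a b x => by rw [map_mul]; rfl
      act_smul := fun c a x => map_smul (φ a).1 c x
      smul_act := fun c a x => by rw [map_smul]; rfl
      inner := L
      inner_add_left := fun x y z =>
        huniq (InnerModule.add_mem_katsuraIdeal (hLJ x z) (hLJ y z)) <| by
          rw [map_add, hL, hL]
          exact Subtype.ext <| LinearMap.ext fun w => (E.add_act x y (E.inner z w)).symm
      inner_smul_left := fun c x y =>
        huniq (InnerModule.smul_mem_katsuraIdeal c (hLJ x y)) <| by
          rw [map_smul, hL]
          exact Subtype.ext <| LinearMap.ext fun w => (E.smul_act c x (E.inner y w)).symm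
      inner_act_left := hact
      star_inner := hstar
      inner_self_nonneg := fun x =>
        InnerModule.exists_eq_star_mul_self hf hA hbij.injOn (hLJ x x) (hstar x x) (hL x x)
      inner_self_eq_zero := fun x => by
        rw [← E.inner_self_eq_zero]
        constructor <;> intro h <;> refine hA.ext fun i => ?_
        · rw [sub_zero, ← hLn, h, CStarSeminorm.apply_zero]
        · rw [sub_zero, hLn, h, CStarSeminorm.apply_zero]
      complete := by
        simp only [hLn]
        exact E.complete }
  refine ⟨⟨M, E, fun x y z => ?_, fun i a x => ?_, fun i b x => ?_⟩, rfl, fun _ _ => rfl⟩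
  · change (φ (L x y)) z = _
    rw [hL]
    rfl
  -- Contractivity of `φ` is not assumed. It follows by computing the seminorm of `φ(a) x` on the
  -- left, as that of `a L(x,x) a*`.
  · refine (pow_le_pow_iff_left₀ (E.toInnerModule.seminorm_nonneg _ _)
      (mul_nonneg ((p i).nonneg a) (E.toInnerModule.seminorm_nonneg _ _)) two_ne_zero).1 ?_
    rw [mul_pow, InnerModule.seminorm_sq, InnerModule.seminorm_sq, ← hLn, ← hLn]
    change p i (L ((φ a) x) ((φ a) x)) ≤ _
    rw [hact, ← hstar, hact, star_mul, hstar, ← mul_assoc]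
    calc p i (a * L x x * star a) ≤ p i a * p i (L x x) * p i (star a) :=
          ((p i).mul_le _ _).trans (mul_le_mul_of_nonneg_right ((p i).mul_le _ _) ((p i).nonneg _))
      _ = _ := by rw [(p i).star_eq]; ring
  · have h1 : ∀ y, M.seminorm i y = E.toInnerModule.seminorm (p i) y := fun y =>
      congrArg Real.sqrt (hLn i y)
    rw [h1, h1]
    exact E.toInnerModule.seminorm_act_le (p i) x b

end

end ProCStar

end

theorem proposition6p6 {A : Type u} [NonUnitalRing A] [StarRing A] [Module ℂ A]
    [IsScalarTower ℂ A A] [SMulCommClass ℂ A A] [StarModule ℂ A] [UniformSpace A]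
    {X : Type v} [AddCommGroup X] [Module ℂ X] {Λ : Type w}
    (p : Λ → ProCStar.CStarSeminorm A) (hA : ProCStar.IsProCStarAlgebra p)
    (E : ProCStar.HilbertProModule p X)
    (φ : A →⋆ₙₐ[ℂ] E.toInnerModule.Adj p) (hφ : Continuous φ) :
    (∃ M : ProCStar.HilbertProBimodule p p X,
        M.right = E ∧ ∀ a x, M.left.act a x = (φ a) x) ↔
      ((∃ h : Set.MapsTo φ (ProCStar.katsuraIdeal E.toInnerModule φ)
            (E.toInnerModule.compacts p), IsHomeomorph h.restrict) ∧
        ∀ a ∈ ProCStar.katsuraIdeal E.toInnerModule φ, ∀ i,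
          E.toInnerModule.opNorm p i (φ a) = ENNReal.ofReal (p i a)) := by
  constructor
  · rintro ⟨M, rfl, hM⟩
    have h := ProCStar.HilbertProBimodule.mapsTo_compacts hM hA
    refine ⟨⟨h, ?_⟩, fun a ha i => ?_⟩
    · refine ProCStar.InnerModule.isHomeomorph_restrict hA hφ h
        (ProCStar.HilbertProBimodule.surjOn_compacts hM hA) fun i a ha b hb => ?_
      rw [← map_sub]
      exact ProCStar.HilbertProBimodule.opNorm_eq hM hA
        (sub_mem (ProCStar.InnerModule.mem_katsuraIdeal.1 ha i).2
          (ProCStar.InnerModule.mem_katsuraIdeal.1 hb i).2)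
    · exact ProCStar.HilbertProBimodule.opNorm_eq hM hA
        (ProCStar.InnerModule.mem_katsuraIdeal.1 ha i).2
  · rintro ⟨⟨h, hh⟩, hnorm⟩
    refine E.exists_bimodule hA φ
      (fun i a => E.toInnerModule.opNorm_ne_top_of_continuous p i φ hA hφ a)
      ⟨h, h.restrict_inj.1 hh.bijective.1, ?_⟩ hnorm
    exact h.restrict_surjective_iff.1 hh.bijective.2
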